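/- Let $a<b$, $T>0$, $\delta>0$, $\nu>0$ and an integer $k\ge 0$ be fixed. Let $\gamma:\mathbb R\to[0,\infty)$ be even, with $\gamma\in L^1_{\rm loc}(\mathbb R)$ and $0<\int_{-\delta}^{\delta}s^2\gamma(s)\,ds<\infty$. Let $(u,q)$ be a solution, $(b-a)$-periodic in $x$, of the nonlocal wave equation $$u_{tt}(x,t)-2\int_0^\delta s^2\gamma(s)\,\tfrac1s\big(q(x,t;s)-q(x-s,t;s)\big)\,ds=0,\qquad q(x,t;s)=\tfrac1s\big(u(x+s,t)-u(x,t)\big),\quad 0<s\le\delta,$$ for $(x,t)\in(a,b)\times(0,T)$ (the second relation for all $x\in\mathbb R$, $t\in[0,T]$), smooth in the sense that $u,u_t,u_{tt}$ exist and are continuous on $\mathbb R\times[0,T]$ and $u(\cdot,t),u_t(\cdot,t)\in C^{k+1}(\mathbb R)$ for every $t\in[0,T]$. Let $A$ be such that for all $t\in[0,T]$ and $s\in(0,\delta]$ $$|u(\cdot,t)|_{H^{k+1}(a,b)}\le A,\qquad |u_t(\cdot,t)|_{H^{k+1}(a,b)}\le A,\qquad |q(\cdot,t;s)|_{H^{k+1}(a,b)}\le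 A,$$ where $|f|_{H^{m}(a,b)}=\|f^{(m)}\|_{L^2(a,b)}$. Let $a=x_{1/2}<x_{3/2}<\dots<x_{N+1/2}=b$ be a partition into cells $I_j=(x_{j-1/2},x_{j+1/2})$ of lengths $h_j$, put $h=\max_j h_j$, and assume $\nu h\le\min_j h_j$. Let $V_h^k$ be the space of functions that are polynomials of degree at most $k$ on each $I_j$, extended $(b-a)$-periodically to $\mathbb R$, and let $P_h$ denote the $L^2$-projection onto $V_h^k$. Let $(u_h,q_h)$ be the semi-discrete discontinuous Galerkin solution: $u_h(\cdot,t),q_h(\cdot,t;s)\in V_h^k$ for $t\in[0,T]$ and $s\in(0,\delta]$, $u_h$ is twice continuously differentiable in $t\in[0,T]$, and for all $t\in[0,T]$, all $j$ and all $v,w\in V_h^k$ $$\int_{I_j}(u_h)_{tt}\,v\,dx-2\int_0^\delta s^2\gamma(s)\int_{I_j}\tfrac1s\big(q_h(x,t;s)-q_h(x-s,t;s)\big)v(x)\,dx\,ds=0,$$ $$\int_{I_j}q_h(x,t;s)\,w(x)\,dx-\int_{I_j}\tfrac1s\big(u_h(x+s,t)-u_h(x,t)\big)w(x)\,dx=0\qquad(0<s\le\delta),$$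 with initial data $u_h(\cdot,0)=P_hu(\cdot,0)$ and $(u_h)_t(\cdot,0)=P_hu_t(\cdot,0)$. Then the error $e_u=u_h-u$ satisfies $$\|e_u(\cdot,t)\|_{L^2(a,b)}^2\le C\,h^{2k+2}\qquad\text{for all }t\in[0,T],$$ with a constant $C>0$ that depends only on $\gamma$, $\delta$, $A$, $k$, $T$, $a$, $b$ and $\nu$; in particular $C$ is independent of the partition and of $h$. -/

import Mathlib

open MeasureTheory Set

namespace NonlocalWave

noncomputable section

/-- The time derivative, on the closed interval `[0, T]`, of a function `u t x` of time and space
(one-sided at the two endpoints). -/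
def timeDeriv (T : ℝ) (u : ℝ → ℝ → ℝ) (t x : ℝ) : ℝ :=
  derivWithin (fun r => u r x) (Icc 0 T) t

/-- The Sobolev seminorm `|f|_{H^m(a,b)} = ‖f^{(m)}‖_{L²(a,b)}` of a function of class `C^m`. -/
def sobolevSeminorm (a b : ℝ) (m : ℕ) (f : ℝ → ℝ) : ℝ :=
  Real.sqrt (∫ x in a..b, (iteratedDeriv m f x) ^ 2)

/-- A nonnegative radial kernel `γ(x, y) = γ(x - y)` with
`0 < C_δ = ∫_{-δ}^{δ} s² γ(s) ds < ∞`. -/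
structure IsKernel (δ : ℝ) (γ : ℝ → ℝ) : Prop where
  nonneg : ∀ s, 0 ≤ γ s
  even : ∀ s, γ (-s) = γ s
  integrable : IntervalIntegrable (fun s => s ^ 2 * γ s) volume (-δ) δ
  pos : 0 < ∫ s in (-δ)..δ, s ^ 2 * γ s

/-- `(u, q)`, written `u t x` and `q t s x`, is a smooth `(b - a)`-periodic solution on `[0, T]` of
the nonlocal wave equation in first order form
`u_tt = 2 ∫_0^δ s² γ(s) (1/s) (q(x,t;s) - q(x-s,t;s)) ds`,
`q(x,t;s) = (1/s) (u(x+s,t) - u(x,t))`,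
where `u` and `u_t` are of class `C^{k+1}` in space and `u`, `u_t`, `u_tt` are jointly continuous. -/
structure IsSmoothSolution (a b T δ : ℝ) (γ : ℝ → ℝ) (k : ℕ)
    (u : ℝ → ℝ → ℝ) (q : ℝ → ℝ → ℝ → ℝ) : Prop where
  periodic : ∀ t ∈ Icc 0 T, Function.Periodic (u t) (b - a)
  contDiff_time : ∀ x, ContDiffOn ℝ 2 (fun t => u t x) (Icc 0 T)
  continuous_u : ContinuousOn (fun p : ℝ × ℝ => u p.1 p.2) (Icc 0 T ×ˢ univ)
  continuous_ut : ContinuousOn (fun p : ℝ × ℝ => timeDeriv T u p.1 p.2) (Icc 0 T ×ˢ univ)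
  continuous_utt :
    ContinuousOn (fun p : ℝ × ℝ => timeDeriv T (timeDeriv T u) p.1 p.2) (Icc 0 T ×ˢ univ)
  contDiff_u : ∀ t ∈ Icc 0 T, ContDiff ℝ ((k + 1 : ℕ) : WithTop ℕ∞) (u t)
  contDiff_ut : ∀ t ∈ Icc 0 T, ContDiff ℝ ((k + 1 : ℕ) : WithTop ℕ∞) (timeDeriv T u t)
  wave_eq : ∀ t ∈ Ioo 0 T, ∀ x ∈ Ioo a b,
    timeDeriv T (timeDeriv T u) t x
      - 2 * ∫ s in (0 : ℝ)..δ, s ^ 2 * γ s * ((1 / s) * (q t s x - q t s (x - s))) = 0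
  grad_eq : ∀ t ∈ Icc 0 T, ∀ s ∈ Ioc 0 δ, ∀ x,
    q t s x - (1 / s) * (u t (x + s) - u t x) = 0

/-- A partition `a = node 0 < node 1 < ⋯ < node N = b` of the interval `(a, b)`. -/
structure Mesh (a b : ℝ) where
  N : ℕ
  node : Fin (N + 1) → ℝ
  strictMono : StrictMono node
  node_zero : node 0 = a
  node_last : node (Fin.last N) = b

namespace Mesh

variable {a b : ℝ}

/-- The left endpoint of the cell `I_j`. -/
def left (M : Mesh a b) (j : Fin M.N) : ℝ := M.node j.castSucc

/-- The right endpoint of the cell `I_j`. -/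
def right (M : Mesh a b) (j : Fin M.N) : ℝ := M.node j.succ

/-- The length `h_j` of the cell `I_j`. -/
def cellLength (M : Mesh a b) (j : Fin M.N) : ℝ := M.right j - M.left j

/-- The mesh size `h = max_j h_j`. -/
def size (M : Mesh a b) : ℝ := ⨆ j, M.cellLength j

/-- Regularity of the partition: `ν max_j h_j ≤ min_j h_j`. -/
def IsRegular (M : Mesh a b) (ν : ℝ) : Prop := ∀ j, ν * M.size ≤ M.cellLength j

/-- The space `V_h^k` of functions that are polynomials of degree at most `k` on each open cell,
extended `(b - a)`-periodically to the line (the values at the nodes are immaterial). -/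
def dgSpace (M : Mesh a b) (k : ℕ) : Submodule ℝ (ℝ → ℝ) where
  carrier := {v | Function.Periodic v (b - a) ∧ ∀ j : Fin M.N, ∃ p : Polynomial ℝ,
    p.natDegree ≤ k ∧ ∀ x ∈ Ioo (M.left j) (M.right j), v x = p.eval x}
  zero_mem' := ⟨fun _ => rfl, fun _ => ⟨0, by simp, by simp⟩⟩
  add_mem' := by
    rintro v w ⟨hv, hv'⟩ ⟨hw, hw'⟩
    refine ⟨hv.add hw, fun j => ?_⟩
    obtain ⟨p, hp, hp'⟩ := hv' j
    obtain ⟨r, hr, hr'⟩ := hw' j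
    refine ⟨p + r, Polynomial.natDegree_add_le_of_degree_le hp hr, fun x hx => ?_⟩
    simp [hp' x hx, hr' x hx]
  smul_mem' := by
    rintro c v ⟨hv, hv'⟩
    refine ⟨hv.smul c, fun j => ?_⟩
    obtain ⟨p, hp, hp'⟩ := hv' j
    refine ⟨c • p, (Polynomial.natDegree_smul_le c p).trans hp, fun x hx => ?_⟩
    simp [hp' x hx]

/-- `H_j(v, w; s) = ∫_{I_j} (1/s) (v(x+s) - v(x)) w(x) dx`. -/
def opH (M : Mesh a b) (j : Fin M.N) (v w : ℝ → ℝ) (s : ℝ) : ℝ :=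
  ∫ x in (M.left j)..(M.right j), (1 / s) * (v (x + s) - v x) * w x

/-- `K_j(v, w; s) = ∫_{I_j} (1/s) (v(x) - v(x-s)) w(x) dx`. -/
def opK (M : Mesh a b) (j : Fin M.N) (v w : ℝ → ℝ) (s : ℝ) : ℝ :=
  ∫ x in (M.left j)..(M.right j), (1 / s) * (v x - v (x - s)) * w x

/-- `g = P_h f` is the `L²`-projection of `f` onto `V_h^k`. -/
def IsL2Projection (M : Mesh a b) (k : ℕ) (f g : ℝ → ℝ) : Prop :=
  g ∈ M.dgSpace k ∧ ∀ j : Fin M.N, ∀ p : Polynomial ℝ, p.natDegree ≤ k →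
    ∫ x in (M.left j)..(M.right j), (f x - g x) * p.eval x = 0

/-- `(u_h, q_h)`, written `uh t x` and `qh t s x`, solves the semi-discrete discontinuous Galerkin
scheme on `[0, T]`: it takes values in `V_h^k`, `u_h` is twice continuously differentiable in time,
and on every cell and for all test functions in `V_h^k`
`∫_{I_j} (u_h)_tt v dx - 2 ∫_0^δ s² γ(s) K_j(q_h, v; s) ds = 0`,
`∫_{I_j} q_h w dx - H_j(u_h, w; s) = 0` for `0 < s ≤ δ`. -/
structure IsDGSolution (M : Mesh a b) (k : ℕ) (T δ : ℝ) (γ : ℝ → ℝ)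
    (uh : ℝ → ℝ → ℝ) (qh : ℝ → ℝ → ℝ → ℝ) : Prop where
  mem_uh : ∀ t ∈ Icc 0 T, uh t ∈ M.dgSpace k
  mem_qh : ∀ t ∈ Icc 0 T, ∀ s ∈ Ioc 0 δ, qh t s ∈ M.dgSpace k
  contDiff_time : ∀ j : Fin M.N, ∀ x ∈ Ioo (M.left j) (M.right j),
    ContDiffOn ℝ 2 (fun t => uh t x) (Icc 0 T)
  wave_eq : ∀ t ∈ Icc 0 T, ∀ v ∈ M.dgSpace k, ∀ j : Fin M.N,
    (∫ x in (M.left j)..(M.right j), timeDeriv T (timeDeriv T uh) t x * v x)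
      - 2 * ∫ s in (0 : ℝ)..δ, s ^ 2 * γ s * M.opK j (qh t s) v s = 0
  grad_eq : ∀ t ∈ Icc 0 T, ∀ s ∈ Ioc 0 δ, ∀ w ∈ M.dgSpace k, ∀ j : Fin M.N,
    (∫ x in (M.left j)..(M.right j), qh t s x * w x) - M.opH j (uh t) w s = 0

end Mesh

end

end NonlocalWave

namespace NonlocalWave

noncomputable section

/-! Because `γ` is integrable near the origin, the nonlocal operator has order zero. The weight `s²`
cancels the factors `1/s` of the two successive difference quotients, so the operator and its
discretization are both bounded on `L²(a, b)`. Write `Γ` for the integral of `γ` over `(0, δ)`, and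
let `ε` bound the distance from `u` and `q` to the discrete space. Then
`Mesh.abs_sum_integral_opK_sub_le` estimates the difference of the discrete and exact operators,
tested with `φ`, by `8 Γ (‖u_h - u‖ + δ ε) ‖φ‖`. Taylor polynomials on the cells allow `ε = A
h^(k+1)` (`Mesh.exists_mem_dgSpace_l2norm_sub_le`).

The error equation can therefore be treated like an ordinary differential equation with bounded
right-hand side, without an energy identity. For a test function `φ` that does not depend on time,
it is integrated twice in time. The errors of the initial position and velocity vanish against `φ`,
because the initial data are projections (`Mesh.abs_integral_error_mul_le`). At a given time `t` one
then takes `φ = u_h(t) - v`, with `v` an approximant of `u(t)`.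

If the error is at most `R e^(λt)` on `[0, T]`, the two integrations return `(8 Γ / λ²) R e^(λt)`
plus a multiple of `ε`. With `λ² = 16 Γ + 1` the factor is at most one half, and
`le_of_forall_bound_improves` absorbs it. This is carried out in `Mesh.l2norm_error_le`.

Two regularity questions remain. The scheme gives no measurability of `q_h` in `s`; it is recovered
by expressing `q_h` through moments of `u_h` (`exists_dual_polynomials`). Smoothness of `u_h` in
time is given only for each fixed `x`; Lagrange interpolation on a cell upgrades it to joint
continuity (`isBddContOn_of_polynomial`). -/

/-! ### Essentially bounded functions and the `L²` norm over a period. -/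

/-- The norm of `L²(a, b)`. -/
def l2norm (a b : ℝ) (f : ℝ → ℝ) : ℝ := Real.sqrt (∫ x in a..b, f x ^ 2)

theorem l2norm_nonneg (a b : ℝ) (f : ℝ → ℝ) : 0 ≤ l2norm a b f := Real.sqrt_nonneg _

theorem l2norm_sq {a b : ℝ} (hab : a ≤ b) (f : ℝ → ℝ) :
    l2norm a b f ^ 2 = ∫ x in a..b, f x ^ 2 :=
  Real.sq_sqrt (intervalIntegral.integral_nonneg hab fun _ _ => sq_nonneg _)

/-- Membership in `L^∞` of the whole line is the working integrability condition: it survives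
products, differences and translations, and gives integrability on every bounded interval. -/
theorem intervalIntegrable_of_memLp_top {f : ℝ → ℝ} (hf : MemLp f ⊤ volume) (l r : ℝ) :
    IntervalIntegrable f volume l r := by
  rw [intervalIntegrable_iff]
  have : IsFiniteMeasure (volume.restrict (uIoc l r)) := ⟨by simp [uIoc]⟩
  exact (hf.restrict _).integrable le_top

theorem memLp_top_mul {f g : ℝ → ℝ} (hf : MemLp f ⊤ volume) (hg : MemLp g ⊤ volume) :
    MemLp (fun x => f x * g x) ⊤ volume :=
  hg.mul hf

theorem memLp_top_sub {f g : ℝ → ℝ} (hf : MemLp f ⊤ volume) (hg : MemLp g ⊤ volume) :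
    MemLp (fun x => f x - g x) ⊤ volume :=
  hf.sub hg

theorem memLp_top_comp_add {f : ℝ → ℝ} (hf : MemLp f ⊤ volume) (s : ℝ) :
    MemLp (fun x => f (x + s)) ⊤ volume :=
  hf.comp_measurePreserving (measurePreserving_add_right volume s)

theorem exists_abs_le_of_continuous_periodic {f : ℝ → ℝ} {p : ℝ} (hp : 0 < p)
    (hf : Continuous f) (hper : Function.Periodic f p) : ∃ C, ∀ x, |f x| ≤ C := by
  obtain ⟨C, hC⟩ := isCompact_Icc.exists_bound_of_continuousOn (s := Icc 0 (0 + p)) hf.continuousOn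
  refine ⟨C, fun x => ?_⟩
  obtain ⟨y, hy, hxy⟩ := hper.exists_mem_Ico hp x 0
  rw [hxy]
  exact hC y (Ico_subset_Icc_self hy)

theorem memLp_top_of_continuous_periodic {f : ℝ → ℝ} {p : ℝ} (hp : 0 < p) (hf : Continuous f)
    (hper : Function.Periodic f p) : MemLp f ⊤ volume := by
  obtain ⟨C, hC⟩ := exists_abs_le_of_continuous_periodic hp hf hper
  exact memLp_top_of_bound hf.aestronglyMeasurable C (Filter.Eventually.of_forall hC)

theorem intervalIntegrable_sq_of_memLp_top {f : ℝ → ℝ} (hf : MemLp f ⊤ volume) (l r : ℝ) :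
    IntervalIntegrable (fun x => f x ^ 2) volume l r := by
  simpa only [sq] using intervalIntegrable_of_memLp_top (memLp_top_mul hf hf) l r

theorem sq_integral_mul_le {a b : ℝ} (hab : a ≤ b) {f g : ℝ → ℝ}
    (hff : IntervalIntegrable (fun x => f x ^ 2) volume a b)
    (hgg : IntervalIntegrable (fun x => g x ^ 2) volume a b)
    (hfg : IntervalIntegrable (fun x => f x * g x) volume a b) :
    (∫ x in a..b, f x * g x) ^ 2 ≤ (∫ x in a..b, f x ^ 2) * ∫ x in a..b, g x ^ 2 := by
  -- The integral of `(t f + g)²` is a nonnegative quadratic in `t`; its discriminant is the claim.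
  have key : ∀ t : ℝ, 0 ≤ (∫ x in a..b, f x ^ 2) * (t * t) + (2 * ∫ x in a..b, f x * g x) * t
      + ∫ x in a..b, g x ^ 2 := by
    intro t
    have h : ∫ x in a..b, (t * f x + g x) ^ 2 = (∫ x in a..b, f x ^ 2) * (t * t)
        + (2 * ∫ x in a..b, f x * g x) * t + ∫ x in a..b, g x ^ 2 := by
      have : ∀ x, (t * f x + g x) ^ 2 = (t * t) * f x ^ 2 + (2 * t) * (f x * g x) + g x ^ 2 := by
        intro x; ring
      simp_rw [this]
      rw [intervalIntegral.integral_add ((hff.const_mul _).add (hfg.const_mul _)) hgg,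
        intervalIntegral.integral_add (hff.const_mul _) (hfg.const_mul _),
        intervalIntegral.integral_const_mul, intervalIntegral.integral_const_mul]
      ring
    rw [← h]
    exact intervalIntegral.integral_nonneg hab fun _ _ => sq_nonneg _
  have hd := discrim_le_zero key
  rw [discrim] at hd
  nlinarith

/-- The Cauchy-Schwarz inequality on a bounded interval. -/
theorem abs_integral_mul_le_l2norm {a b : ℝ} (hab : a ≤ b) {f g : ℝ → ℝ}
    (hf : MemLp f ⊤ volume) (hg : MemLp g ⊤ volume) :
    |∫ x in a..b, f x * g x| ≤ l2norm a b f * l2norm a b g := by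
  apply abs_le_of_sq_le_sq _ (mul_nonneg (l2norm_nonneg _ _ _) (l2norm_nonneg _ _ _))
  rw [mul_pow, l2norm_sq hab, l2norm_sq hab]
  exact sq_integral_mul_le hab (intervalIntegrable_sq_of_memLp_top hf a b)
    (intervalIntegrable_sq_of_memLp_top hg a b)
    (intervalIntegrable_of_memLp_top (memLp_top_mul hf hg) a b)

theorem l2norm_add_le {a b : ℝ} (hab : a ≤ b) {f g : ℝ → ℝ}
    (hf : MemLp f ⊤ volume) (hg : MemLp g ⊤ volume) :
    l2norm a b (fun x => f x + g x) ≤ l2norm a b f + l2norm a b g := by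
  have hff := intervalIntegrable_sq_of_memLp_top hf a b
  have hgg := intervalIntegrable_sq_of_memLp_top hg a b
  have hfg := intervalIntegrable_of_memLp_top (memLp_top_mul hf hg) a b
  apply le_of_sq_le_sq _ (add_nonneg (l2norm_nonneg _ _ _) (l2norm_nonneg _ _ _))
  have h : l2norm a b (fun x => f x + g x) ^ 2 =
      l2norm a b f ^ 2 + 2 * (∫ x in a..b, f x * g x) + l2norm a b g ^ 2 := by
    rw [l2norm_sq hab, l2norm_sq hab, l2norm_sq hab]
    simp_rw [add_sq, mul_assoc]
    rw [intervalIntegral.integral_add (hff.add (hfg.const_mul _)) hgg,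
        intervalIntegral.integral_add hff (hfg.const_mul _), intervalIntegral.integral_const_mul]
  rw [h]
  have := (le_abs_self _).trans (abs_integral_mul_le_l2norm hab hf hg)
  nlinarith

theorem l2norm_const_mul {a b : ℝ} (c : ℝ) (f : ℝ → ℝ) :
    l2norm a b (fun x => c * f x) = |c| * l2norm a b f := by
  simp only [l2norm, mul_pow, intervalIntegral.integral_const_mul]
  rw [Real.sqrt_mul (sq_nonneg c), Real.sqrt_sq_eq_abs]

theorem l2norm_sub_comm {a b : ℝ} (f g : ℝ → ℝ) :
    l2norm a b (fun x => f x - g x) = l2norm a b (fun x => g x - f x) := by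
  simp only [l2norm]
  congr 2
  funext x
  ring

theorem l2norm_comp_add {a b : ℝ} {f : ℝ → ℝ} (hf : Function.Periodic f (b - a)) (s : ℝ) :
    l2norm a b (fun x => f (x + s)) = l2norm a b f := by
  simp only [l2norm]
  congr 1
  have hper : Function.Periodic (fun x => f x ^ 2) (b - a) := fun x => by simp only [hf x]
  rw [intervalIntegral.integral_comp_add_right (fun x => f x ^ 2) s]
  have := hper.intervalIntegral_add_eq (a + s) a
  rwa [show a + s + (b - a) = b + s by ring, show a + (b - a) = b by ring] at this

theorem l2norm_le_of_integral_sq_le {a b B : ℝ} (hab : a ≤ b) {f : ℝ → ℝ}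
    (h : ∫ x in a..b, f x ^ 2 ≤ B * l2norm a b f) (hB : 0 ≤ B) : l2norm a b f ≤ B := by
  rw [← l2norm_sq hab] at h
  rcases (l2norm_nonneg a b f).eq_or_lt with h0 | h0
  · rwa [← h0]
  · rw [sq] at h
    exact le_of_mul_le_mul_right h h0

/-! ### Cells of a partition and periodic gluing. -/

namespace Mesh

variable {a b : ℝ}

theorem left_lt_right (M : Mesh a b) (j : Fin M.N) : M.left j < M.right j :=
  M.strictMono j.castSucc_lt_succ

theorem a_le_node (M : Mesh a b) (i : Fin (M.N + 1)) : a ≤ M.node i := by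
  conv_lhs => rw [← M.node_zero]
  exact M.strictMono.monotone (Fin.zero_le i)

theorem node_le_b (M : Mesh a b) (i : Fin (M.N + 1)) : M.node i ≤ b := by
  conv_rhs => rw [← M.node_last]
  exact M.strictMono.monotone (Fin.le_last i)

theorem cellLength_pos (M : Mesh a b) (j : Fin M.N) : 0 < M.cellLength j :=
  sub_pos.2 (M.left_lt_right j)

theorem cellLength_le_size (M : Mesh a b) (j : Fin M.N) : M.cellLength j ≤ M.size :=
  le_ciSup (Set.finite_range M.cellLength).bddAbove j

theorem size_nonneg (M : Mesh a b) : 0 ≤ M.size :=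
  Real.iSup_nonneg fun j => (M.cellLength_pos j).le

theorem eq_of_mem_cells (M : Mesh a b) {i j : Fin M.N} {x : ℝ}
    (hi : x ∈ Ioo (M.left i) (M.right i)) (hj : x ∈ Ioo (M.left j) (M.right j)) : i = j := by
  by_contra hne
  rcases lt_or_gt_of_ne hne with h | h
  · have : M.right i ≤ M.left j := M.strictMono.monotone (by
      rw [Fin.le_def]; simpa using h)
    linarith [hi.2, hj.1]
  · have : M.right j ≤ M.left i := M.strictMono.monotone (by
      rw [Fin.le_def]; simpa using h)
    linarith [hj.2, hi.1]

theorem exists_left_le_lt_right (M : Mesh a b) {x : ℝ} (hx : x ∈ Ico a b) :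
    ∃ j, M.left j ≤ x ∧ x < M.right j := by
  have key : ∀ i : Fin (M.N + 1), x < M.node i → ∃ j, M.left j ≤ x ∧ x < M.right j := by
    intro i
    induction i using Fin.induction with
    | zero =>
      intro h
      rw [M.node_zero] at h
      exact absurd hx.1 h.not_ge
    | succ j ih =>
      intro h
      by_cases h' : x < M.node j.castSucc
      · exact ih h'
      · exact ⟨j, not_lt.1 h', h⟩
  exact key (Fin.last _) (by rw [M.node_last]; exact hx.2)

/-- Integration over `(a, b)` is summation of integrals over the cells. -/
theorem sum_integral_cells (M : Mesh a b) {f : ℝ → ℝ}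
    (hf : ∀ l r, IntervalIntegrable f volume l r) :
    ∑ j, ∫ x in (M.left j)..(M.right j), f x = ∫ x in a..b, f x := by
  -- Induction over the nodes: the cells to the left of node `i` fill the interval from `a` to that
  -- node.
  have key : ∀ i : Fin (M.N + 1), ∑ j : Fin M.N, (if j.castSucc < i then
      ∫ x in (M.left j)..(M.right j), f x else 0) = ∫ x in a..(M.node i), f x := by
    intro i
    induction i using Fin.induction with
    | zero => simp [M.node_zero]
    | succ n ih =>
      have h : ∀ j : Fin M.N, (if j.castSucc < n.succ then
          ∫ x in (M.left j)..(M.right j), f x else 0) =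
          (if j.castSucc < n.castSucc then ∫ x in (M.left j)..(M.right j), f x else 0) +
          (if j = n then ∫ x in (M.left j)..(M.right j), f x else 0) := by
        intro j
        by_cases h1 : j < n
        · have h2 : j ≠ n := h1.ne
          simp [h1, h2, Fin.lt_def, Nat.lt_succ_of_lt (Fin.lt_def.1 h1)]
        · by_cases h2 : j = n
          · subst h2
            simp [Fin.lt_def]
          · have h3 : n < j := lt_of_le_of_ne (not_lt.1 h1) (Ne.symm h2)
            have h4 : ¬ (j : ℕ) < n := by simpa using h1
            have h5 : ¬ (j : ℕ) < n + 1 := by have := Fin.lt_def.1 h3; omega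
            simp [h2, Fin.lt_def, h4, h5]
      rw [Finset.sum_congr rfl fun j _ => h j, Finset.sum_add_distrib, ih, Finset.sum_ite_eq']
      simp only [Finset.mem_univ, if_true]
      exact intervalIntegral.integral_add_adjacent_intervals (hf _ _) (hf _ _)
  have := key (Fin.last _)
  rw [M.node_last] at this
  rw [← this]
  refine Finset.sum_congr rfl fun j _ => ?_
  rw [if_pos (Fin.castSucc_lt_last j)]

/-- The `(b - a)`-periodic function that agrees with `f j` on the `j`-th open cell and vanishes at
the nodes. -/
def glue (M : Mesh a b) (hab : a < b) (f : Fin M.N → ℝ → ℝ) (x : ℝ) : ℝ :=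
  ∑ j, (Ioo (M.left j) (M.right j)).indicator (f j) (toIcoMod (sub_pos.2 hab) a x)

theorem glue_of_toIcoMod_mem (M : Mesh a b) (hab : a < b) (f : Fin M.N → ℝ → ℝ) {x : ℝ}
    {j : Fin M.N} (hx : toIcoMod (sub_pos.2 hab) a x ∈ Ioo (M.left j) (M.right j)) :
    M.glue hab f x = f j (toIcoMod (sub_pos.2 hab) a x) := by
  rw [glue, Finset.sum_eq_single j, indicator_of_mem hx]
  · intro i _ hij
    exact indicator_of_notMem (fun hi => hij (M.eq_of_mem_cells hi hx)) _
  · simp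

theorem toIcoMod_of_mem_cell (M : Mesh a b) (hab : a < b) {x : ℝ} {j : Fin M.N}
    (hx : x ∈ Ioo (M.left j) (M.right j)) : toIcoMod (sub_pos.2 hab) a x = x := by
  rw [toIcoMod_eq_self]
  have h1 := M.a_le_node j.castSucc
  have h2 := M.node_le_b j.succ
  exact ⟨h1.trans hx.1.le, by rw [add_sub_cancel]; exact hx.2.trans_le h2⟩

theorem glue_of_mem_cell (M : Mesh a b) (hab : a < b) (f : Fin M.N → ℝ → ℝ) {x : ℝ}
    {j : Fin M.N} (hx : x ∈ Ioo (M.left j) (M.right j)) : M.glue hab f x = f j x := by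
  have h := M.toIcoMod_of_mem_cell hab hx
  rw [M.glue_of_toIcoMod_mem hab f (j := j) (by rwa [h]), h]

theorem glue_periodic (M : Mesh a b) (hab : a < b) (f : Fin M.N → ℝ → ℝ) :
    Function.Periodic (M.glue hab f) (b - a) := by
  intro x
  simp only [glue, toIcoMod_add_right]

theorem glue_mem_dgSpace (M : Mesh a b) (hab : a < b) {k : ℕ} (P : Fin M.N → Polynomial ℝ)
    (hP : ∀ j, (P j).natDegree ≤ k) : M.glue hab (fun j x => (P j).eval x) ∈ M.dgSpace k :=
  ⟨M.glue_periodic hab _, fun j => ⟨P j, hP j, fun _ hx => M.glue_of_mem_cell hab _ hx⟩⟩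

theorem measurable_toIcoMod {p : ℝ} (hp : 0 < p) (c : ℝ) : Measurable (toIcoMod hp c) := by
  have : toIcoMod hp c = fun x => c + Int.fract ((x - c) / p) * p := by
    funext x
    exact toIcoMod_eq_add_fract_mul hp c x
  rw [this]
  fun_prop

/-- Almost every point is, modulo the period, in the interior of a cell. -/
theorem ae_exists_toIcoMod_mem (M : Mesh a b) (hab : a < b) :
    ∀ᵐ x : ℝ, ∃ j, toIcoMod (sub_pos.2 hab) a x ∈ Ioo (M.left j) (M.right j) := by
  -- The exceptional set consists of the periodic translates of the nodes, hence is countable.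
  have hc : (⋃ i : Fin (M.N + 1), ⋃ n : ℤ, {M.node i + n • (b - a)}).Countable :=
    countable_iUnion fun i => countable_iUnion fun n => countable_singleton _
  have := hc.ae_notMem (volume : Measure ℝ)
  filter_upwards [this] with x hx
  have hm := toIcoMod_mem_Ico (sub_pos.2 hab) a x
  rw [add_sub_cancel] at hm
  obtain ⟨j, h1, h2⟩ := M.exists_left_le_lt_right hm
  refine ⟨j, lt_of_le_of_ne h1 fun h => hx ?_, h2⟩
  simp only [mem_iUnion, mem_singleton_iff]
  refine ⟨j.castSucc, toIcoDiv (sub_pos.2 hab) a x, ?_⟩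
  have h3 : M.node j.castSucc = _ := h
  rw [h3, toIcoMod_add_toIcoDiv_zsmul]

/-- Two periodic functions that agree on the open cells agree almost everywhere. -/
theorem ae_eq_of_eq_on_cells (M : Mesh a b) (hab : a < b) {v w : ℝ → ℝ}
    (hv : Function.Periodic v (b - a)) (hw : Function.Periodic w (b - a))
    (h : ∀ j, ∀ x ∈ Ioo (M.left j) (M.right j), v x = w x) : v =ᵐ[volume] w := by
  filter_upwards [M.ae_exists_toIcoMod_mem hab] with x hx
  obtain ⟨j, hj⟩ := hx
  have := h j _ hj
  rwa [toIcoMod, hv.sub_zsmul_eq, hw.sub_zsmul_eq] at this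

theorem measurable_glue (M : Mesh a b) (hab : a < b) {f : Fin M.N → ℝ → ℝ}
    (hf : ∀ j, Measurable (f j)) : Measurable (M.glue hab f) := by
  refine Finset.measurable_sum _ fun j _ => ?_
  exact ((hf j).indicator measurableSet_Ioo).comp (measurable_toIcoMod _ _)

theorem memLp_top_glue (M : Mesh a b) (hab : a < b) {f : Fin M.N → ℝ → ℝ}
    (hf : ∀ j, Continuous (f j)) : MemLp (M.glue hab f) ⊤ volume := by
  have h : ∀ j, ∃ C, ∀ x ∈ Icc (M.left j) (M.right j), ‖f j x‖ ≤ C := fun j =>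
    isCompact_Icc.exists_bound_of_continuousOn (hf j).continuousOn
  choose C hC using h
  have hC0 : ∀ j, 0 ≤ C j := fun j =>
    (norm_nonneg _).trans (hC j _ (left_mem_Icc.2 (M.left_lt_right j).le))
  refine memLp_top_of_bound (M.measurable_glue hab fun j =>
    (hf j).measurable).aestronglyMeasurable (∑ j, C j) (Filter.Eventually.of_forall fun x => ?_)
  refine norm_sum_le_of_le _ fun j _ => ?_
  by_cases hx : toIcoMod (sub_pos.2 hab) a x ∈ Ioo (M.left j) (M.right j)
  · rw [indicator_of_mem hx]
    exact hC j _ (Ioo_subset_Icc_self hx)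
  · rw [indicator_of_notMem hx, norm_zero]
    exact hC0 j

/-- Node values are arbitrary, so `v` need not be given by its polynomials everywhere; it agrees
almost everywhere with the gluing of those polynomials, which is measurable and bounded. -/
theorem memLp_top_of_mem_dgSpace (M : Mesh a b) (hab : a < b) {k : ℕ} {v : ℝ → ℝ}
    (hv : v ∈ M.dgSpace k) : MemLp v ⊤ volume := by
  choose P hP hvP using hv.2
  refine (memLp_congr_ae ?_).1 (M.memLp_top_glue hab fun j => (P j).continuous)
  exact M.ae_eq_of_eq_on_cells hab (M.glue_periodic hab _) hv.1 fun j x hx => by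
    rw [M.glue_of_mem_cell hab _ hx, hvP j x hx]

/-- An integral over a cell only sees the values in its interior. -/
theorem integral_cell_congr (M : Mesh a b) (j : Fin M.N) {f g : ℝ → ℝ}
    (h : ∀ x ∈ Ioo (M.left j) (M.right j), f x = g x) :
    ∫ x in (M.left j)..(M.right j), f x = ∫ x in (M.left j)..(M.right j), g x := by
  rw [intervalIntegral.integral_of_le (M.left_lt_right j).le,
    intervalIntegral.integral_of_le (M.left_lt_right j).le,
    integral_Ioc_eq_integral_Ioo, integral_Ioc_eq_integral_Ioo]
  exact setIntegral_congr_fun measurableSet_Ioo h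

end Mesh

/-! ### Approximation by Taylor polynomials on cells. -/

/-- The Taylor polynomial of degree `k` of `f` at `c`. -/
def taylorPoly (f : ℝ → ℝ) (k : ℕ) (c : ℝ) : Polynomial ℝ :=
  ∑ i ∈ Finset.range (k + 1),
    Polynomial.C ((i.factorial : ℝ)⁻¹ * iteratedDeriv i f c) * (Polynomial.X - Polynomial.C c) ^ i

theorem natDegree_taylorPoly_le (f : ℝ → ℝ) (k : ℕ) (c : ℝ) : (taylorPoly f k c).natDegree ≤ k := by
  refine Polynomial.natDegree_sum_le_of_forall_le _ _ fun i hi => ?_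
  refine (Polynomial.natDegree_C_mul_le _ _).trans ?_
  refine (Polynomial.natDegree_pow_le).trans ?_
  rw [Polynomial.natDegree_X_sub_C, mul_one]
  exact Nat.lt_succ_iff.1 (Finset.mem_range.1 hi)

theorem sub_eval_taylorPoly {f : ℝ → ℝ} {k : ℕ}
    (hf : ContDiff ℝ ((k + 1 : ℕ) : WithTop ℕ∞) f) {c x : ℝ} (hcx : c < x) :
    f x - (taylorPoly f k c).eval x =
      ∫ y in c..x, ((x - y) ^ k / k.factorial) * iteratedDeriv (k + 1) f y := by
  have hu : UniqueDiffOn ℝ (uIcc c x) := uniqueDiffOn_uIcc hcx.ne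
  have hd : ∀ i ≤ k + 1, ∀ y ∈ uIcc c x,
      iteratedDerivWithin i f (uIcc c x) y = iteratedDeriv i f y := fun i hi y hy =>
    iteratedDerivWithin_eq_iteratedDeriv hu
      ((hf.of_le (by exact_mod_cast hi)).contDiffAt) hy
  have h := taylor_integral_remainder (n := k) (hf.contDiffOn (s := uIcc c x))
  have h1 : taylorWithinEval f k (uIcc c x) c x = (taylorPoly f k c).eval x := by
    rw [taylor_within_apply, taylorPoly, Polynomial.eval_finsetSum]
    refine Finset.sum_congr rfl fun i hi => ?_
    rw [hd i (Finset.mem_range.1 hi).le c left_mem_uIcc]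
    simp only [Polynomial.eval_mul, Polynomial.eval_C, Polynomial.eval_pow, Polynomial.eval_sub,
      Polynomial.eval_X, smul_eq_mul]
    ring
  rw [h1] at h
  rw [h]
  refine intervalIntegral.integral_congr fun y hy => ?_
  simp only [smul_eq_mul]
  rw [hd _ le_rfl y hy]

/-- The error of the Taylor polynomial at the left endpoint, in `L²` of the interval. -/
theorem integral_sub_taylorPoly_sq_le {f : ℝ → ℝ} {k : ℕ}
    (hf : ContDiff ℝ ((k + 1 : ℕ) : WithTop ℕ∞) f) {l r : ℝ} (hlr : l < r) :
    ∫ x in l..r, (f x - (taylorPoly f k l).eval x) ^ 2 ≤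
      (r - l) ^ (2 * k + 2) * ∫ x in l..r, iteratedDeriv (k + 1) f x ^ 2 := by
  set g := iteratedDeriv (k + 1) f with hg
  have hgc : Continuous g := hf.continuous_iteratedDeriv (k + 1) le_rfl
  set S := ∫ x in l..r, g x ^ 2 with hS
  -- Cauchy-Schwarz on the integral remainder, with `1 / k!` bounded by one. The last power of `r -
  -- l` comes from integrating this bound in `x`.
  have hpt : ∀ x ∈ Ioc l r, (f x - (taylorPoly f k l).eval x) ^ 2 ≤ (r - l) ^ (2 * k + 1) * S := by
    intro x hx
    rw [sub_eval_taylorPoly hf hx.1]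
    have hw : Continuous fun y => (x - y) ^ k / (k.factorial : ℝ) := by fun_prop
    have hcs : (∫ y in l..x, ((x - y) ^ k / k.factorial) * g y) ^ 2 ≤
        (∫ y in l..x, ((x - y) ^ k / (k.factorial : ℝ)) ^ 2) * ∫ y in l..x, g y ^ 2 :=
      sq_integral_mul_le hx.1.le ((hw.pow 2).intervalIntegrable _ _)
        ((hgc.pow 2).intervalIntegrable _ _) ((hw.mul hgc).intervalIntegrable _ _)
    refine hcs.trans ?_
    have h1 : ∫ y in l..x, ((x - y) ^ k / (k.factorial : ℝ)) ^ 2 ≤ (r - l) ^ (2 * k + 1) := by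
      have : ∫ y in l..x, ((x - y) ^ k / (k.factorial : ℝ)) ^ 2 ≤
          ∫ _ in l..x, (r - l) ^ (2 * k) := by
        refine intervalIntegral.integral_mono_on hx.1.le ((hw.pow 2).intervalIntegrable _ _)
          intervalIntegrable_const fun y hy => ?_
        have h0 : 0 ≤ x - y := by linarith [hy.2]
        have hfac : (1 : ℝ) ≤ k.factorial := by exact_mod_cast Nat.succ_le_of_lt k.factorial_pos
        have h2 : (x - y) ^ k / (k.factorial : ℝ) ≤ (r - l) ^ k :=
          (div_le_self (pow_nonneg h0 k) hfac).trans
            (pow_le_pow_left₀ h0 (by linarith [hx.2, hy.1]) k)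
        rw [mul_comm 2 k, pow_mul]
        exact pow_le_pow_left₀ (by positivity) h2 2
      refine this.trans ?_
      rw [intervalIntegral.integral_const, smul_eq_mul, pow_succ, mul_comm]
      have : 0 ≤ (r - l) ^ (2 * k) := pow_nonneg (sub_nonneg.2 hlr.le) _
      exact mul_le_mul_of_nonneg_left (by linarith [hx.2]) this
    have h2 : ∫ y in l..x, g y ^ 2 ≤ S :=
      intervalIntegral.integral_mono_interval le_rfl hx.1.le hx.2
        (Filter.Eventually.of_forall fun y => sq_nonneg _) ((hgc.pow 2).intervalIntegrable _ _)
    exact mul_le_mul h1 h2 (intervalIntegral.integral_nonneg hx.1.le fun _ _ => sq_nonneg _)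
      (pow_nonneg (sub_nonneg.2 hlr.le) _)
  calc ∫ x in l..r, (f x - (taylorPoly f k l).eval x) ^ 2
      ≤ ∫ _ in l..r, (r - l) ^ (2 * k + 1) * S := by
        refine intervalIntegral.integral_mono_on_of_le_Ioo hlr.le ?_ intervalIntegrable_const
          fun x hx => hpt x (Ioo_subset_Ioc_self hx)
        exact ((hf.continuous.sub (taylorPoly f k l).continuous).pow 2).intervalIntegrable _ _
    _ = (r - l) ^ (2 * k + 2) * S := by
        rw [intervalIntegral.integral_const, smul_eq_mul]
        ring

/-- Approximation of smooth periodic functions by the discontinuous Galerkin space. -/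
theorem Mesh.exists_mem_dgSpace_l2norm_sub_le {a b : ℝ} (M : Mesh a b) (hab : a < b) {k : ℕ}
    {f : ℝ → ℝ} (hf : ContDiff ℝ ((k + 1 : ℕ) : WithTop ℕ∞) f)
    (hper : Function.Periodic f (b - a)) :
    ∃ v ∈ M.dgSpace k,
      l2norm a b (fun x => v x - f x) ≤ M.size ^ (k + 1) * sobolevSeminorm a b (k + 1) f := by
  refine ⟨_, M.glue_mem_dgSpace hab (fun j => taylorPoly f k (M.left j))
    fun j => natDegree_taylorPoly_le _ _ _, ?_⟩
  set v := M.glue hab fun j x => (taylorPoly f k (M.left j)).eval x with hv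
  have hvL : MemLp v ⊤ volume := M.memLp_top_glue hab fun j => (taylorPoly f k _).continuous
  have hfL := memLp_top_of_continuous_periodic (sub_pos.2 hab) hf.continuous hper
  have hgc : Continuous (iteratedDeriv (k + 1) f) := hf.continuous_iteratedDeriv (k + 1) le_rfl
  change _ ≤ _ * l2norm a b (iteratedDeriv (k + 1) f)
  apply le_of_sq_le_sq _ (mul_nonneg (pow_nonneg M.size_nonneg _) (l2norm_nonneg _ _ _))
  rw [l2norm_sq hab.le, mul_pow, l2norm_sq hab.le,
    ← M.sum_integral_cells (fun l r => intervalIntegrable_sq_of_memLp_top (memLp_top_sub hvL hfL) l r),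
    ← M.sum_integral_cells (f := fun x => iteratedDeriv (k + 1) f x ^ 2)
      (fun l r => (hgc.pow 2).intervalIntegrable l r), Finset.mul_sum]
  refine Finset.sum_le_sum fun j _ => ?_
  rw [M.integral_cell_congr j (g := fun x => (f x - (taylorPoly f k (M.left j)).eval x) ^ 2)]
  · refine (integral_sub_taylorPoly_sq_le hf (M.left_lt_right j)).trans ?_
    refine mul_le_mul_of_nonneg_right ?_
      (intervalIntegral.integral_nonneg (M.left_lt_right j).le fun _ _ => sq_nonneg _)
    rw [← pow_mul, show (k + 1) * 2 = 2 * k + 2 by ring]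
    exact pow_le_pow_left₀ (M.cellLength_pos j).le (M.cellLength_le_size j) _
  · intro x hx
    simp only [hv]
    rw [M.glue_of_mem_cell hab _ hx]
    ring

/-! ### Regularity in time and integration in time. -/

/-- Continuity and boundedness on `[0, T] × (l, r)`. -/
def IsBddContOn (T l r : ℝ) (G : ℝ → ℝ → ℝ) : Prop :=
  ContinuousOn (fun p : ℝ × ℝ => G p.1 p.2) (Icc 0 T ×ˢ Ioo l r) ∧
    ∃ B, ∀ t ∈ Icc 0 T, ∀ x ∈ Ioo l r, |G t x| ≤ B

theorem IsBddContOn.sub {T l r : ℝ} {F G : ℝ → ℝ → ℝ} (hF : IsBddContOn T l r F)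
    (hG : IsBddContOn T l r G) : IsBddContOn T l r (fun t x => F t x - G t x) := by
  obtain ⟨hF1, B, hB⟩ := hF
  obtain ⟨hG1, D, hD⟩ := hG
  exact ⟨hF1.sub hG1, B + D, fun t ht x hx =>
    (abs_sub _ _).trans (add_le_add (hB t ht x hx) (hD t ht x hx))⟩

theorem isBddContOn_of_continuousOn {T : ℝ} {G : ℝ → ℝ → ℝ}
    (hG : ContinuousOn (fun p : ℝ × ℝ => G p.1 p.2) (Icc 0 T ×ˢ univ)) (l r : ℝ) :
    IsBddContOn T l r G := by
  refine ⟨hG.mono (prod_mono le_rfl (subset_univ _)), ?_⟩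
  obtain ⟨B, hB⟩ := (isCompact_Icc.prod isCompact_Icc).exists_bound_of_continuousOn
    (hG.mono (prod_mono le_rfl (subset_univ (Icc l r))))
  exact ⟨B, fun t ht x hx => hB (t, x) ⟨ht, Ioo_subset_Icc_self hx⟩⟩

/-- Lagrange interpolation at points of an open interval. -/
theorem exists_lagrange_nodes (k : ℕ) {l r : ℝ} (hlr : l < r) :
    ∃ (y : Fin (k + 1) → ℝ) (L : Fin (k + 1) → Polynomial ℝ), (∀ i, y i ∈ Ioo l r) ∧
      (∀ i, (L i).natDegree ≤ k) ∧ ∀ p : Polynomial ℝ, p.natDegree ≤ k →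
        ∀ x, p.eval x = ∑ i, p.eval (y i) * (L i).eval x := by
  -- The shift by one and the denominator `k + 2` keep all points strictly inside: at the endpoints
  -- a discrete function is neither polynomial nor regular in time.
  set y : Fin (k + 1) → ℝ := fun i => l + (r - l) * (((i : ℕ) + 1 : ℝ) / (k + 2)) with hy
  have hpos : 0 < r - l := sub_pos.2 hlr
  have hk : (0 : ℝ) < k + 2 := by positivity
  have hinj : Function.Injective y := by
    intro i j hij
    simp only [hy, add_right_inj, mul_eq_mul_left_iff, hpos.ne', or_false] at hij
    rw [div_left_inj' hk.ne', add_left_inj] at hij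
    exact Fin.ext (by exact_mod_cast hij)
  refine ⟨y, Lagrange.basis Finset.univ y, fun i => ⟨?_, ?_⟩, fun i => ?_, fun p hp x => ?_⟩
  · simp only [hy]
    have : 0 < (r - l) * (((i : ℕ) + 1 : ℝ) / (k + 2)) := by positivity
    linarith
  · have h1 : (((i : ℕ) + 1 : ℝ) / (k + 2)) < 1 := by
      rw [div_lt_one hk]
      have : ((i : ℕ) : ℝ) < k + 1 := by exact_mod_cast i.2
      linarith
    have := mul_lt_mul_of_pos_left h1 hpos
    simp only [hy]
    linarith
  · rw [Lagrange.natDegree_basis hinj.injOn (Finset.mem_univ i)]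
    simp
  · have hdeg : p.degree < (Finset.univ : Finset (Fin (k + 1))).card := by
      refine (Polynomial.degree_le_natDegree).trans_lt ?_
      rw [Finset.card_univ, Fintype.card_fin]
      exact_mod_cast Nat.lt_succ_of_le hp
    conv_lhs => rw [Lagrange.eq_interpolate hinj.injOn hdeg, Lagrange.interpolate_apply]
    simp [Polynomial.eval_finsetSum]

/-- Interpolation at fixed points writes `w` as a finite sum of continuous functions of `t` times
polynomials in `x`, so separate regularity becomes joint continuity. -/
theorem isBddContOn_of_polynomial {T l r : ℝ} (hlr : l < r) {k : ℕ} {w : ℝ → ℝ → ℝ}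
    (hw : ∀ t ∈ Icc 0 T, ∃ p : Polynomial ℝ, p.natDegree ≤ k ∧ ∀ x ∈ Ioo l r, w t x = p.eval x)
    (hc : ∀ x ∈ Ioo l r, ContinuousOn (fun t => w t x) (Icc 0 T)) : IsBddContOn T l r w := by
  obtain ⟨y, L, hy, -, hyL⟩ := exists_lagrange_nodes k hlr
  have hrep : ∀ t ∈ Icc 0 T, ∀ x ∈ Ioo l r, w t x = ∑ i, w t (y i) * (L i).eval x := by
    intro t ht x hx
    obtain ⟨p, hp, hpw⟩ := hw t ht
    rw [hpw x hx, hyL p hp x]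
    exact Finset.sum_congr rfl fun i _ => by rw [hpw _ (hy i)]
  set W : ℝ → ℝ → ℝ := fun t x => ∑ i, w t (y i) * (L i).eval x with hW
  have hWc : ContinuousOn (fun p : ℝ × ℝ => W p.1 p.2) (Icc 0 T ×ˢ univ) := by
    refine continuousOn_finsetSum _ fun i _ => ContinuousOn.mul ?_ ?_
    · exact (hc _ (hy i)).comp continuousOn_fst fun p hp => hp.1
    · exact ((L i).continuous.comp continuous_snd).continuousOn
  obtain ⟨h1, B, hB⟩ := isBddContOn_of_continuousOn hWc l r
  exact ⟨h1.congr fun p hp => hrep _ hp.1 _ hp.2, B, fun t ht x hx => by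
    rw [hrep t ht x hx]; exact hB t ht x hx⟩

/-- The interpolation formula has coefficients `w t (y i)` and basis polynomials independent of `t`,
so it may be differentiated in time term by term. -/
theorem exists_polynomial_timeDeriv {T l r : ℝ} (hlr : l < r) {k : ℕ} {w : ℝ → ℝ → ℝ}
    (hw : ∀ t ∈ Icc 0 T, ∃ p : Polynomial ℝ, p.natDegree ≤ k ∧ ∀ x ∈ Ioo l r, w t x = p.eval x)
    (hd : ∀ x ∈ Ioo l r, DifferentiableOn ℝ (fun t => w t x) (Icc 0 T)) :
    ∀ t ∈ Icc 0 T, ∃ p : Polynomial ℝ, p.natDegree ≤ k ∧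
      ∀ x ∈ Ioo l r, timeDeriv T w t x = p.eval x := by
  obtain ⟨y, L, hy, hL, hyL⟩ := exists_lagrange_nodes k hlr
  have hrep : ∀ t ∈ Icc 0 T, ∀ x ∈ Ioo l r, w t x = ∑ i, w t (y i) * (L i).eval x := by
    intro t ht x hx
    obtain ⟨p, hp, hpw⟩ := hw t ht
    rw [hpw x hx, hyL p hp x]
    exact Finset.sum_congr rfl fun i _ => by rw [hpw _ (hy i)]
  intro t ht
  refine ⟨∑ i, Polynomial.C (timeDeriv T w t (y i)) * L i,
    Polynomial.natDegree_sum_le_of_forall_le _ _ fun i _ =>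
      (Polynomial.natDegree_C_mul_le _ _).trans (hL i), fun x hx => ?_⟩
  rw [timeDeriv, derivWithin_congr (fun s hs => hrep s hs x hx) (hrep t ht x hx),
    derivWithin_fun_sum fun i _ => ((hd _ (hy i)) t ht).mul_const _]
  rw [Polynomial.eval_finsetSum]
  refine Finset.sum_congr rfl fun i _ => ?_
  rw [derivWithin_mul_const ((hd _ (hy i)) t ht)]
  simp [timeDeriv]

theorem hasDerivAt_timeDeriv {T : ℝ} {w : ℝ → ℝ → ℝ} {x : ℝ}
    (hd : DifferentiableOn ℝ (fun t => w t x) (Icc 0 T)) {t : ℝ} (ht : t ∈ Ioo 0 T) :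
    HasDerivAt (fun t => w t x) (timeDeriv T w t x) t :=
  ((hd t (Ioo_subset_Icc_self ht)).hasDerivWithinAt).hasDerivAt (Icc_mem_nhds ht.1 ht.2)

theorem contDiffOn_one_timeDeriv {T : ℝ} (hT : 0 < T) {w : ℝ → ℝ → ℝ} {x : ℝ}
    (hw : ContDiffOn ℝ 2 (fun t => w t x) (Icc 0 T)) :
    ContDiffOn ℝ 1 (fun t => timeDeriv T w t x) (Icc 0 T) :=
  hw.derivWithin (uniqueDiffOn_Icc hT) (by norm_num)

theorem continuousOn_timeDeriv {T : ℝ} (hT : 0 < T) {w : ℝ → ℝ → ℝ} {x : ℝ}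
    (hw : ContDiffOn ℝ 1 (fun t => w t x) (Icc 0 T)) :
    ContinuousOn (fun t => timeDeriv T w t x) (Icc 0 T) :=
  hw.continuousOn_derivWithin (uniqueDiffOn_Icc hT) le_rfl

theorem IsBddContOn.integrable_prod {T l r : ℝ} {G : ℝ → ℝ → ℝ}
    (hG : IsBddContOn T l r G) {φ : ℝ → ℝ} (hφ : Continuous φ) {t : ℝ} (ht : t ∈ Icc 0 T) :
    Integrable (fun p : ℝ × ℝ => G p.2 p.1 * φ p.1)
      ((volume.restrict (Ioo l r)).prod (volume.restrict (Ioc 0 t))) := by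
  obtain ⟨hc, B, hB⟩ := hG
  obtain ⟨D, hD⟩ := isCompact_Icc.exists_bound_of_continuousOn (s := Icc l r) hφ.continuousOn
  have hsub : Ioc 0 t ⊆ Icc 0 T := fun s hs => ⟨hs.1.le, hs.2.trans ht.2⟩
  rw [Measure.prod_restrict]
  have hfin : IsFiniteMeasure
      ((volume.prod volume : Measure (ℝ × ℝ)).restrict (Ioo l r ×ˢ Ioc 0 t)) := by
    rw [← Measure.prod_restrict]
    infer_instance
  have hm : MeasurableSet (Ioo l r ×ˢ Ioc 0 t) := measurableSet_Ioo.prod measurableSet_Ioc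
  refine Integrable.of_bound (C := |B| * |D|) ?_ ?_
  · refine ContinuousOn.aestronglyMeasurable ?_ hm
    refine ContinuousOn.mul ?_ (hφ.comp continuous_fst).continuousOn
    exact hc.comp (f := fun p : ℝ × ℝ => (p.2, p.1)) continuous_swap.continuousOn
      fun p hp => ⟨hsub hp.2, hp.1⟩
  · refine (ae_restrict_iff' hm).2 (Filter.Eventually.of_forall fun p hp => ?_)
    rw [norm_mul]
    exact mul_le_mul ((hB _ (hsub hp.2) _ hp.1).trans (le_abs_self _))
      ((hD _ (Ioo_subset_Icc_self hp.1)).trans (le_abs_self _)) (norm_nonneg _) (abs_nonneg _)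

theorem IsBddContOn.integrable_slice {T l r : ℝ} {G : ℝ → ℝ → ℝ}
    (hG : IsBddContOn T l r G) {φ : ℝ → ℝ} (hφ : Continuous φ) {t : ℝ} (ht : t ∈ Icc 0 T) :
    Integrable (fun x => G t x * φ x) (volume.restrict (Ioo l r)) := by
  obtain ⟨hc, B, hB⟩ := hG
  obtain ⟨D, hD⟩ := isCompact_Icc.exists_bound_of_continuousOn (s := Icc l r) hφ.continuousOn
  refine Integrable.of_bound (C := |B| * |D|) ?_ ?_
  · refine ContinuousOn.aestronglyMeasurable (ContinuousOn.mul ?_ hφ.continuousOn) measurableSet_Ioo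
    exact hc.comp (f := fun x : ℝ => (t, x)) (by fun_prop) fun x hx => ⟨ht, hx⟩
  · refine (ae_restrict_iff' measurableSet_Ioo).2 (Filter.Eventually.of_forall fun x hx => ?_)
    rw [norm_mul]
    exact mul_le_mul ((hB _ ht _ hx).trans (le_abs_self _))
      ((hD _ (Ioo_subset_Icc_self hx)).trans (le_abs_self _)) (norm_nonneg _) (abs_nonneg _)

/-- The fundamental theorem of calculus in time, tested in space. -/
theorem integral_mul_sub_eq_integral_timeDeriv {T l r : ℝ} (hlr : l ≤ r)
    {F G : ℝ → ℝ → ℝ} (hF : IsBddContOn T l r F) (hG : IsBddContOn T l r G)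
    (hd : ∀ x ∈ Ioo l r, ∀ t ∈ Ioo 0 T, HasDerivAt (fun t => F t x) (G t x) t)
    {φ : ℝ → ℝ} (hφ : Continuous φ) {t : ℝ} (ht : t ∈ Icc 0 T) :
    IntervalIntegrable (fun τ => ∫ x in l..r, G τ x * φ x) volume 0 t ∧
    (∫ x in l..r, F t x * φ x) - ∫ x in l..r, F 0 x * φ x =
      ∫ τ in (0 : ℝ)..t, ∫ x in l..r, G τ x * φ x := by
  have h0 : (0 : ℝ) ∈ Icc 0 T := ⟨le_rfl, ht.1.trans ht.2⟩
  simp only [intervalIntegral.integral_of_le hlr, intervalIntegral.integral_of_le ht.1,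
    integral_Ioc_eq_integral_Ioo (x := l), intervalIntegrable_iff_integrableOn_Ioc_of_le ht.1]
  refine ⟨(hG.integrable_prod hφ ht).integral_prod_right, ?_⟩
  -- Fubini reduces the claim to the fundamental theorem of calculus in `t` at each fixed `x`.
  rw [← integral_sub (hF.integrable_slice hφ ht) (hF.integrable_slice hφ h0),
    integral_integral_swap (f := fun τ x => G τ x * φ x) (hG.integrable_prod hφ ht).swap]
  refine setIntegral_congr_fun measurableSet_Ioo fun x hx => ?_
  rw [integral_mul_const, ← sub_mul, ← intervalIntegral.integral_of_le ht.1]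
  congr 1
  have hsub : Icc 0 t ⊆ Icc 0 T := fun s hs => ⟨hs.1, hs.2.trans ht.2⟩
  have hGc : ContinuousOn (fun s => G s x) (Icc 0 t) :=
    hG.1.comp (f := fun s : ℝ => (s, x)) (by fun_prop) fun s hs => ⟨hsub hs, hx⟩
  have hFc : ContinuousOn (fun s => F s x) (Icc 0 t) :=
    hF.1.comp (f := fun s : ℝ => (s, x)) (by fun_prop) fun s hs => ⟨hsub hs, hx⟩
  refine (intervalIntegral.integral_eq_sub_of_hasDerivAt_of_le ht.1 hFc
    (fun s hs => hd x hx s ⟨hs.1, hs.2.trans_le ht.2⟩) ?_).symm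
  exact (uIcc_of_le ht.1 ▸ hGc : ContinuousOn (fun s => G s x) (uIcc 0 t)).intervalIntegrable

/-- Integrating a second order differential inequality with exponential bound twice. -/
theorem abs_le_of_second_order {T α β lam : ℝ} (hα : 0 ≤ α) (hβ : 0 ≤ β)
    (hlam : 0 < lam) {c d g : ℝ → ℝ} (hc0 : c 0 = 0) (hd0 : d 0 = 0)
    (hc : ∀ t ∈ Icc 0 T, c t - c 0 = ∫ τ in (0 : ℝ)..t, d τ)
    (hd : ∀ t ∈ Icc 0 T, d t - d 0 = ∫ τ in (0 : ℝ)..t, g τ)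
    (hg : ∀ t ∈ Ioo 0 T, |g t| ≤ α * Real.exp (lam * t) + β) :
    ∀ t ∈ Icc 0 T, |c t| ≤ α / lam ^ 2 * Real.exp (lam * t) + β * T ^ 2 := by
  have hexp : ∀ κ μ t : ℝ, 0 ≤ κ → 0 ≤ μ → 0 ≤ t → t ≤ T →
      ∫ τ in (0 : ℝ)..t, (κ * Real.exp (lam * τ) + μ) ≤ κ / lam * Real.exp (lam * t) + μ * T := by
    intro κ μ t hκ hμ h0 ht
    have hder : ∀ τ ∈ uIcc 0 t, HasDerivAt (fun τ => κ / lam * Real.exp (lam * τ) + μ * τ)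
        (κ * Real.exp (lam * τ) + μ) τ := by
      intro τ _
      have h1 : HasDerivAt (fun τ => κ / lam * Real.exp (lam * τ) + μ * τ)
          (κ / lam * (Real.exp (lam * τ) * (lam * 1)) + μ * 1) τ := (((hasDerivAt_id τ).const_mul lam).exp.const_mul (κ / lam)).add
        ((hasDerivAt_id τ).const_mul μ)
      refine h1.congr_deriv ?_
      field_simp
    rw [intervalIntegral.integral_eq_sub_of_hasDerivAt hder
      (Continuous.intervalIntegrable (by fun_prop) _ _)]
    have h2 : 0 ≤ κ / lam * Real.exp (lam * 0) := by positivity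
    have h3 : μ * t ≤ μ * T := mul_le_mul_of_nonneg_left ht hμ
    linarith
  -- The bound on `g` holds only in the open time interval; the endpoint `T` is a null set.
  have hTne : ∀ᵐ τ : ℝ, τ ≠ T := by simp [ae_iff]
  have hdle : ∀ t ∈ Icc 0 T, |d t| ≤ α / lam * Real.exp (lam * t) + β * T := by
    intro t ht
    have h1 := hd t ht
    rw [hd0, sub_zero] at h1
    rw [h1, ← Real.norm_eq_abs]
    refine (intervalIntegral.norm_integral_le_of_norm_le ht.1 ?_
      (Continuous.intervalIntegrable (by fun_prop) _ _)).trans (hexp α β t hα hβ ht.1 ht.2)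
    filter_upwards [hTne] with τ hτ hτt
    rw [Real.norm_eq_abs]
    exact hg τ ⟨hτt.1, lt_of_le_of_ne (hτt.2.trans ht.2) hτ⟩
  intro t ht
  have hT : 0 ≤ T := ht.1.trans ht.2
  have h1 := hc t ht
  rw [hc0, sub_zero] at h1
  rw [h1, ← Real.norm_eq_abs]
  refine (intervalIntegral.norm_integral_le_of_norm_le ht.1
    (Filter.Eventually.of_forall fun τ hτ => (Real.norm_eq_abs _).trans_le <| hdle τ ⟨hτ.1.le, hτ.2.trans ht.2⟩)
    (Continuous.intervalIntegrable (by fun_prop) _ _)).trans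
    ((hexp (α / lam) (β * T) t (by positivity) (by positivity) ht.1 ht.2).trans_eq ?_)
  field_simp

/-- A Gronwall argument: a bounded function whose exponentially weighted supremum bound improves by
a factor of two up to a constant is controlled by that constant. -/
theorem le_of_forall_bound_improves {T K lam : ℝ} {m : ℝ → ℝ} (hT : 0 ≤ T) (hlam : 0 ≤ lam)
    (hm0 : ∀ t ∈ Icc 0 T, 0 ≤ m t) (hm : ∃ B, ∀ t ∈ Icc 0 T, m t ≤ B)
    (h : ∀ R, 0 ≤ R → (∀ t ∈ Icc 0 T, m t ≤ R * Real.exp (lam * t)) →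
      ∀ t ∈ Icc 0 T, m t ≤ (R / 2 + K) * Real.exp (lam * t)) :
    ∀ t ∈ Icc 0 T, m t ≤ 2 * K * Real.exp (lam * t) := by
  have h0 : (0 : ℝ) ∈ Icc 0 T := ⟨le_rfl, hT⟩
  have hb : BddAbove ((fun t => m t * Real.exp (-(lam * t))) '' Icc 0 T) := by
    obtain ⟨B, hB⟩ := hm
    refine ⟨B, ?_⟩
    rintro _ ⟨t, ht, rfl⟩
    have h1 : Real.exp (-(lam * t)) ≤ 1 := Real.exp_le_one_iff.2 (by
      have := mul_nonneg hlam ht.1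
      linarith)
    exact (mul_le_of_le_one_right (hm0 t ht) h1).trans (hB t ht)
  set S := sSup ((fun t => m t * Real.exp (-(lam * t))) '' Icc 0 T) with hS
  have hconv : ∀ t R, m t ≤ R * Real.exp (lam * t) ↔ m t * Real.exp (-(lam * t)) ≤ R := by
    intro t R
    rw [Real.exp_neg, ← div_eq_mul_inv, div_le_iff₀ (Real.exp_pos _)]
  have hle : ∀ t ∈ Icc 0 T, m t * Real.exp (-(lam * t)) ≤ S := fun t ht =>
    le_csSup hb (mem_image_of_mem _ ht)
  have hS0 : 0 ≤ S := (mul_nonneg (hm0 0 h0) (Real.exp_pos _).le).trans (hle 0 h0)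
  -- The weighted supremum `S` is itself an admissible `R`, so `S ≤ S / 2 + K`; since `S` is finite,
  -- `S ≤ 2 K`.
  have himp := h S hS0 fun t ht => (hconv t S).2 (hle t ht)
  have : S ≤ S / 2 + K := by
    refine csSup_le (Set.Nonempty.image _ ⟨0, h0⟩) ?_
    rintro _ ⟨t, ht, rfl⟩
    exact (hconv t _).1 (himp t ht)
  intro t ht
  rw [hconv]
  linarith [hle t ht]

/-! ### Dual bases, measurability of shifts, and difference quotients. -/

/-- The moments on an interval determine polynomials of bounded degree, by means of a dual basis. -/
theorem exists_dual_polynomials (k : ℕ) {l r : ℝ} (hlr : l < r) :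
    ∃ (n : ℕ) (p ψ : Fin n → Polynomial ℝ), (∀ i, (p i).natDegree ≤ k) ∧
      (∀ i, (ψ i).natDegree ≤ k) ∧ ∀ f : Polynomial ℝ, f.natDegree ≤ k →
        ∀ x, f.eval x = ∑ i, (∫ y in l..r, f.eval y * (ψ i).eval y) * (p i).eval x := by
  let V := Polynomial.degreeLT ℝ (k + 1)
  have hint : ∀ f g : Polynomial ℝ,
      IntervalIntegrable (fun y => f.eval y * g.eval y) volume l r := fun f g =>
    (f.continuous.mul g.continuous).intervalIntegrable _ _
  let B : LinearMap.BilinForm ℝ V := LinearMap.mk₂ ℝ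
    (fun f g => ∫ y in l..r, (f : Polynomial ℝ).eval y * (g : Polynomial ℝ).eval y)
    (fun f f' g => by
      simp only [Submodule.coe_add, Polynomial.eval_add, add_mul]
      exact intervalIntegral.integral_add (hint _ _) (hint _ _))
    (fun c f g => by
      simp only [Submodule.coe_smul, Polynomial.eval_smul, smul_eq_mul, mul_assoc]
      exact intervalIntegral.integral_const_mul _ _)
    (fun f g g' => by
      simp only [Submodule.coe_add, Polynomial.eval_add, mul_add]
      exact intervalIntegral.integral_add (hint _ _) (hint _ _))
    (fun c f g => by
      simp only [Submodule.coe_smul, Polynomial.eval_smul, smul_eq_mul, mul_left_comm _ c]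
      exact intervalIntegral.integral_const_mul _ _)
  -- The `L²` pairing is definite because a nonzero polynomial cannot vanish on a whole interval.
  have hdef : ∀ f : V, B f f = 0 → f = 0 := by
    intro f hf
    by_contra hne
    have hne' : (f : Polynomial ℝ) ≠ 0 := fun h => hne (Subtype.ext h)
    have hc : ∃ c ∈ Icc l r, (f : Polynomial ℝ).eval c ≠ 0 := by
      by_contra! h
      exact hne' (Polynomial.eq_zero_of_infinite_isRoot _ ((Icc_infinite hlr).mono h))
    obtain ⟨c, hc, hfc⟩ := hc
    have := intervalIntegral.integral_pos hlr
      (f := fun y => (f : Polynomial ℝ).eval y * (f : Polynomial ℝ).eval y)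
      (Continuous.continuousOn (by fun_prop)) (fun x _ => mul_self_nonneg _)
      ⟨c, hc, mul_self_pos.2 hfc⟩
    exact this.ne' hf
  have hB : B.Nondegenerate := ⟨fun f hf => hdef f (hf f), fun f hf => hdef f (hf f)⟩
  let e := Module.finBasis ℝ V
  have hmem : ∀ f : V, (f : Polynomial ℝ).natDegree ≤ k := by
    intro f
    by_cases h0 : (f : Polynomial ℝ) = 0
    · simp [h0]
    · exact Nat.lt_succ_iff.1 ((Polynomial.natDegree_lt_iff_degree_lt h0).2
        (Polynomial.mem_degreeLT.1 f.2))
  refine ⟨_, fun i => (B.dualBasis hB e i : Polynomial ℝ), fun i => (e i : Polynomial ℝ),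
    fun i => hmem _, fun i => hmem _, fun f hf x => ?_⟩
  have hfV : f ∈ V := Polynomial.mem_degreeLT.2
    ((Polynomial.degree_le_natDegree).trans_lt (by exact_mod_cast Nat.lt_succ_of_le hf))
  have h := (B.dualBasis hB e).sum_repr ⟨f, hfV⟩
  have h' := congrArg (fun g : V => (g : Polynomial ℝ).eval x) h
  simp only [Submodule.coe_sum, Submodule.coe_smul, Polynomial.eval_finsetSum,
    Polynomial.eval_smul, smul_eq_mul, LinearMap.BilinForm.dualBasis_repr_apply] at h'
  exact h'.symm

/-- The shear `(s, x) ↦ (s, s + x)` preserves the product measure, so almost everywhere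
measurability survives the substitution. -/
theorem aestronglyMeasurable_comp_add {v : ℝ → ℝ} (hv : AEStronglyMeasurable v volume) :
    AEStronglyMeasurable (fun p : ℝ × ℝ => v (p.2 + p.1)) (volume.prod volume) := by
  have h := hv.comp_quasiMeasurePreserving (Measure.quasiMeasurePreserving_snd.comp
    (measurePreserving_prod_add (volume : Measure ℝ) (volume : Measure ℝ)).quasiMeasurePreserving)
  refine h.congr (Filter.Eventually.of_forall fun p => ?_)
  simp [add_comm]

theorem aestronglyMeasurable_comp_sub {v : ℝ → ℝ} (hv : AEStronglyMeasurable v volume) :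
    AEStronglyMeasurable (fun p : ℝ × ℝ => v (p.2 - p.1)) (volume.prod volume) := by
  have h := hv.comp_quasiMeasurePreserving (Measure.quasiMeasurePreserving_snd.comp
    (measurePreserving_prod_neg_add (volume : Measure ℝ)
      (volume : Measure ℝ)).quasiMeasurePreserving)
  refine h.congr (Filter.Eventually.of_forall fun p => ?_)
  simp [sub_eq_neg_add]

theorem memLp_top_comp_sub {f : ℝ → ℝ} (hf : MemLp f ⊤ volume) (s : ℝ) :
    MemLp (fun x => f (x - s)) ⊤ volume := by
  simpa only [sub_eq_add_neg] using memLp_top_comp_add hf (-s)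

theorem memLp_top_const_mul {f : ℝ → ℝ} (hf : MemLp f ⊤ volume) (c : ℝ) :
    MemLp (fun x => c * f x) ⊤ volume :=
  hf.const_mul c

/-- The `L²` norm of a difference quotient. -/
theorem l2norm_diffQuot_le {a b : ℝ} (hab : a ≤ b) {v : ℝ → ℝ} (hv : MemLp v ⊤ volume)
    (hper : Function.Periodic v (b - a)) {s : ℝ} (hs : 0 < s) :
    l2norm a b (fun x => (1 / s) * (v (x + s) - v x)) ≤ 2 / s * l2norm a b v := by
  rw [l2norm_const_mul, abs_of_pos (by positivity)]
  have h1 := l2norm_add_le hab (memLp_top_comp_add hv s) (memLp_top_const_mul hv (-1))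
  rw [l2norm_comp_add hper, l2norm_const_mul] at h1
  simp only [abs_neg, abs_one, one_mul, neg_one_mul, ← sub_eq_add_neg] at h1
  calc 1 / s * l2norm a b (fun x => v (x + s) - v x)
      ≤ 1 / s * (l2norm a b v + l2norm a b v) := by gcongr
    _ = 2 / s * l2norm a b v := by ring

theorem l2norm_backward_diffQuot_le {a b : ℝ} (hab : a ≤ b) {v : ℝ → ℝ} (hv : MemLp v ⊤ volume)
    (hper : Function.Periodic v (b - a)) {s : ℝ} (hs : 0 < s) :
    l2norm a b (fun x => (1 / s) * (v x - v (x - s))) ≤ 2 / s * l2norm a b v := by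
  have hper' : Function.Periodic (fun x => v (x - s)) (b - a) := fun x => by
    simp only [← hper (x - s)]
    congr 1
    ring
  have h := l2norm_diffQuot_le hab (memLp_top_comp_sub hv s) hper' hs
  simp only [add_sub_cancel_right] at h
  have h2 : l2norm a b (fun x => v (x - s)) = l2norm a b v := by
    simpa only [sub_eq_add_neg] using l2norm_comp_add hper (-s)
  rwa [h2] at h

theorem l2norm_mono_interval {a b l r : ℝ} (hal : a ≤ l) (hlr : l ≤ r) (hrb : r ≤ b) {v : ℝ → ℝ}
    (hv : MemLp v ⊤ volume) : l2norm l r v ≤ l2norm a b v :=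
  Real.sqrt_le_sqrt <| intervalIntegral.integral_mono_interval hal hlr hrb
    (Filter.Eventually.of_forall fun _ => sq_nonneg _) (intervalIntegrable_sq_of_memLp_top hv a b)

/-! ### The discrete gradient and the nonlocal operator: stability and consistency. -/

namespace Mesh

variable {a b : ℝ}

theorem abs_opK_le (M : Mesh a b) (hab : a < b) (j : Fin M.N) {v φ : ℝ → ℝ}
    (hv : MemLp v ⊤ volume) (hper : Function.Periodic v (b - a)) (hφ : MemLp φ ⊤ volume)
    {s : ℝ} (hs : 0 < s) : |M.opK j v φ s| ≤ 2 / s * l2norm a b v * l2norm a b φ := by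
  have hd : MemLp (fun x => (1 / s) * (v x - v (x - s))) ⊤ volume :=
    memLp_top_const_mul (memLp_top_sub hv (memLp_top_comp_sub hv s)) _
  have h1 := M.a_le_node j.castSucc
  have h2 := M.node_le_b j.succ
  have h3 := (M.left_lt_right j).le
  refine (abs_integral_mul_le_l2norm h3 hd hφ).trans ?_
  exact mul_le_mul ((l2norm_mono_interval h1 h3 h2 hd).trans
    (l2norm_backward_diffQuot_le hab.le hv hper hs)) (l2norm_mono_interval h1 h3 h2 hφ)
    (l2norm_nonneg _ _ _) (mul_nonneg (by positivity) (l2norm_nonneg _ _ _))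

theorem sum_opK (M : Mesh a b) {v φ : ℝ → ℝ} (hv : MemLp v ⊤ volume) (hφ : MemLp φ ⊤ volume)
    (s : ℝ) : ∑ j, M.opK j v φ s = ∫ x in a..b, (1 / s) * (v x - v (x - s)) * φ x :=
  M.sum_integral_cells fun l r => intervalIntegrable_of_memLp_top (memLp_top_mul
    (memLp_top_const_mul (memLp_top_sub hv (memLp_top_comp_sub hv s)) _) hφ) l r

theorem sum_opH (M : Mesh a b) {v φ : ℝ → ℝ} (hv : MemLp v ⊤ volume) (hφ : MemLp φ ⊤ volume)
    (s : ℝ) : ∑ j, M.opH j v φ s = ∫ x in a..b, (1 / s) * (v (x + s) - v x) * φ x :=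
  M.sum_integral_cells fun l r => intervalIntegrable_of_memLp_top (memLp_top_mul
    (memLp_top_const_mul (memLp_top_sub (memLp_top_comp_add hv s) hv) _) hφ) l r

theorem abs_sum_opK_le (M : Mesh a b) (hab : a < b) {v φ : ℝ → ℝ}
    (hv : MemLp v ⊤ volume) (hper : Function.Periodic v (b - a)) (hφ : MemLp φ ⊤ volume)
    {s : ℝ} (hs : 0 < s) : |∑ j, M.opK j v φ s| ≤ 2 / s * l2norm a b v * l2norm a b φ := by
  rw [M.sum_opK hv hφ]
  refine (abs_integral_mul_le_l2norm hab.le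
    (memLp_top_const_mul (memLp_top_sub hv (memLp_top_comp_sub hv s)) _) hφ).trans ?_
  exact mul_le_mul_of_nonneg_right (l2norm_backward_diffQuot_le hab.le hv hper hs)
    (l2norm_nonneg _ _ _)

theorem opK_sub (M : Mesh a b) (j : Fin M.N) {v w φ : ℝ → ℝ} (hv : MemLp v ⊤ volume)
    (hw : MemLp w ⊤ volume) (hφ : MemLp φ ⊤ volume) (s : ℝ) :
    M.opK j (fun x => v x - w x) φ s = M.opK j v φ s - M.opK j w φ s := by
  have h : ∀ {v : ℝ → ℝ}, MemLp v ⊤ volume → IntervalIntegrable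
      (fun x => (1 / s) * (v x - v (x - s)) * φ x) volume (M.left j) (M.right j) := fun hv =>
    intervalIntegrable_of_memLp_top (memLp_top_mul
      (memLp_top_const_mul (memLp_top_sub hv (memLp_top_comp_sub hv s)) _) hφ) _ _
  rw [opK, opK, opK, ← intervalIntegral.integral_sub (h hv) (h hw)]
  congr 1
  funext x
  ring

theorem opK_sum_mul (M : Mesh a b) (j : Fin M.N) {ι : Type*} (S : Finset ι) (c : ι → ℝ)
    {g : ι → ℝ → ℝ} {φ : ℝ → ℝ} (hg : ∀ i, MemLp (g i) ⊤ volume) (hφ : MemLp φ ⊤ volume) (s : ℝ) :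
    M.opK j (fun x => ∑ i ∈ S, c i * g i x) φ s = ∑ i ∈ S, c i * M.opK j (g i) φ s := by
  have h : ∀ i, IntervalIntegrable
      (fun x => (1 / s) * (g i x - g i (x - s)) * φ x) volume (M.left j) (M.right j) := fun i =>
    intervalIntegrable_of_memLp_top (memLp_top_mul
      (memLp_top_const_mul (memLp_top_sub (hg i) (memLp_top_comp_sub (hg i) s)) _) hφ) _ _
  simp only [opK, ← intervalIntegral.integral_const_mul]
  rw [← intervalIntegral.integral_finsetSum fun i _ => (h i).const_mul (c i)]
  congr 1
  funext x
  rw [← Finset.sum_sub_distrib, Finset.mul_sum, Finset.sum_mul]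
  exact Finset.sum_congr rfl fun i _ => by ring

theorem opK_congr_ae (M : Mesh a b) (j : Fin M.N) {v w φ : ℝ → ℝ} (h : v =ᵐ[volume] w) (s : ℝ) :
    M.opK j v φ s = M.opK j w φ s := by
  have h' := (measurePreserving_sub_right volume s).quasiMeasurePreserving.ae_eq_comp h
  refine intervalIntegral.integral_congr_ae ?_
  filter_upwards [h, h'] with x hx hx' _
  simp only [Function.comp_apply] at hx'
  rw [hx, hx']

theorem aestronglyMeasurable_opK (M : Mesh a b) (j : Fin M.N) {v φ : ℝ → ℝ}
    (hv : AEStronglyMeasurable v volume) (hφ : AEStronglyMeasurable φ volume) :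
    AEStronglyMeasurable (fun s => M.opK j v φ s) volume := by
  simp only [opK, intervalIntegral.integral_of_le (M.left_lt_right j).le]
  have h : AEStronglyMeasurable (fun p : ℝ × ℝ => (1 / p.1) * (v p.2 - v (p.2 - p.1)) * φ p.2)
      ((volume : Measure ℝ).prod (volume : Measure ℝ)) :=
    ((Measurable.aestronglyMeasurable (by fun_prop)).mul
      (hv.comp_snd.sub (aestronglyMeasurable_comp_sub hv))).mul hφ.comp_snd
  refine AEStronglyMeasurable.integral_prod_right' (μ := volume)
    (f := fun p : ℝ × ℝ => (1 / p.1) * (v p.2 - v (p.2 - p.1)) * φ p.2)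
    (h.mono_ac ?_)
  exact Measure.AbsolutelyContinuous.rfl.prod Measure.absolutelyContinuous_restrict

theorem aestronglyMeasurable_opH (M : Mesh a b) (j : Fin M.N) {v φ : ℝ → ℝ}
    (hv : AEStronglyMeasurable v volume) (hφ : AEStronglyMeasurable φ volume) :
    AEStronglyMeasurable (fun s => M.opH j v φ s) volume := by
  simp only [opH, intervalIntegral.integral_of_le (M.left_lt_right j).le]
  have h : AEStronglyMeasurable (fun p : ℝ × ℝ => (1 / p.1) * (v (p.2 + p.1) - v p.2) * φ p.2)
      ((volume : Measure ℝ).prod (volume : Measure ℝ)) :=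
    ((Measurable.aestronglyMeasurable (by fun_prop)).mul
      ((aestronglyMeasurable_comp_add hv).sub hv.comp_snd)).mul hφ.comp_snd
  refine AEStronglyMeasurable.integral_prod_right' (μ := volume)
    (f := fun p : ℝ × ℝ => (1 / p.1) * (v (p.2 + p.1) - v p.2) * φ p.2)
    (h.mono_ac ?_)
  exact Measure.AbsolutelyContinuous.rfl.prod Measure.absolutelyContinuous_restrict

/-- The `L²`-projection onto the discontinuous Galerkin space is a best approximation. -/
theorem l2norm_sub_le_of_integral_eq (M : Mesh a b) (hab : a < b) {k : ℕ} {f g : ℝ → ℝ}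
    (hf : MemLp f ⊤ volume) (hg : g ∈ M.dgSpace k)
    (h : ∀ w ∈ M.dgSpace k, ∫ x in a..b, g x * w x = ∫ x in a..b, f x * w x)
    {v : ℝ → ℝ} (hv : v ∈ M.dgSpace k) :
    l2norm a b (fun x => g x - v x) ≤ l2norm a b (fun x => f x - v x) := by
  have hgv : (fun x => g x - v x) ∈ M.dgSpace k := (M.dgSpace k).sub_mem hg hv
  have hgL := M.memLp_top_of_mem_dgSpace hab hg
  have hvL := M.memLp_top_of_mem_dgSpace hab hv
  have hwL := M.memLp_top_of_mem_dgSpace hab hgv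
  have hi : ∀ {p : ℝ → ℝ}, MemLp p ⊤ volume →
      IntervalIntegrable (fun x => p x * (g x - v x)) volume a b := fun hp =>
    intervalIntegrable_of_memLp_top (memLp_top_mul hp hwL) a b
  refine l2norm_le_of_integral_sq_le hab.le ?_ (l2norm_nonneg _ _ _)
  -- Since `g - v` is itself an admissible test function, orthogonality lets `f` replace `g` in one
  -- factor.
  have h1 : ∫ x in a..b, (g x - v x) ^ 2 = ∫ x in a..b, (f x - v x) * (g x - v x) := by
    simp only [sq, sub_mul _ _ (g _ - v _)]
    rw [intervalIntegral.integral_sub (hi hgL) (hi hvL),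
      intervalIntegral.integral_sub (hi hf) (hi hvL), h _ hgv]
  rw [h1]
  exact (le_abs_self _).trans
    (abs_integral_mul_le_l2norm hab.le (memLp_top_sub hf hvL) hwL)

/-- The weak form of the discrete gradient, summed over the cells. -/
theorem integral_mul_eq_of_opH (M : Mesh a b) (hab : a < b) {k : ℕ} {g r : ℝ → ℝ} {s : ℝ}
    (hg : MemLp g ⊤ volume) (hr : MemLp r ⊤ volume)
    (h : ∀ w ∈ M.dgSpace k, ∀ j,
      (∫ x in (M.left j)..(M.right j), r x * w x) - M.opH j g w s = 0) :
    ∀ w ∈ M.dgSpace k, ∫ x in a..b, r x * w x =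
      ∫ x in a..b, (1 / s) * (g (x + s) - g x) * w x := by
  intro w hw
  have hwL := M.memLp_top_of_mem_dgSpace hab hw
  rw [← M.sum_opH hg hwL, ← M.sum_integral_cells fun l r =>
    intervalIntegrable_of_memLp_top (memLp_top_mul hr hwL) l r]
  exact Finset.sum_congr rfl fun j _ => sub_eq_zero.1 (h w hw j)

/-- The discrete gradient is the projection of a difference quotient; comparison with the zero
function shows that projecting does not increase the norm. -/
theorem l2norm_le_of_opH (M : Mesh a b) (hab : a < b) {k : ℕ} {g r : ℝ → ℝ} {s : ℝ} (hs : 0 < s)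
    (hg : MemLp g ⊤ volume) (hper : Function.Periodic g (b - a)) (hr : r ∈ M.dgSpace k)
    (h : ∀ w ∈ M.dgSpace k, ∀ j,
      (∫ x in (M.left j)..(M.right j), r x * w x) - M.opH j g w s = 0) :
    l2norm a b r ≤ 2 / s * l2norm a b g := by
  have hrL := M.memLp_top_of_mem_dgSpace hab hr
  have h1 := M.l2norm_sub_le_of_integral_eq hab
    (memLp_top_const_mul (memLp_top_sub (memLp_top_comp_add hg s) hg) (1 / s)) hr
    (M.integral_mul_eq_of_opH hab hg hrL h) (M.dgSpace k).zero_mem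
  simp only [Pi.zero_apply, sub_zero] at h1
  exact h1.trans (l2norm_diffQuot_le hab.le hg hper hs)

/-- The error of the discrete gradient. -/
theorem l2norm_sub_diffQuot_le (M : Mesh a b) (hab : a < b) {k : ℕ} {g r u : ℝ → ℝ} {s ε : ℝ}
    (hs : 0 < s) (hg : MemLp g ⊤ volume) (hgper : Function.Periodic g (b - a))
    (hr : r ∈ M.dgSpace k) (hu : MemLp u ⊤ volume) (huper : Function.Periodic u (b - a))
    (h : ∀ w ∈ M.dgSpace k, ∀ j,
      (∫ x in (M.left j)..(M.right j), r x * w x) - M.opH j g w s = 0)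
    (happ : ∃ v ∈ M.dgSpace k,
      l2norm a b (fun x => v x - (1 / s) * (u (x + s) - u x)) ≤ ε) :
    l2norm a b (fun x => r x - (1 / s) * (u (x + s) - u x)) ≤
      2 / s * l2norm a b (fun x => g x - u x) + 2 * ε := by
  obtain ⟨v, hv, hvε⟩ := happ
  have hrL := M.memLp_top_of_mem_dgSpace hab hr
  have hvL := M.memLp_top_of_mem_dgSpace hab hv
  have hDg := memLp_top_const_mul (memLp_top_sub (memLp_top_comp_add hg s) hg) (1 / s)
  have hDu := memLp_top_const_mul (memLp_top_sub (memLp_top_comp_add hu s) hu) (1 / s)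
  -- The approximant `v` is inserted twice, before and after projecting; hence `2 ε`.
  have h1 := M.l2norm_sub_le_of_integral_eq hab hDg hr
    (M.integral_mul_eq_of_opH hab hg hrL h) hv
  have h2 := l2norm_add_le hab.le (memLp_top_sub hrL hvL) (memLp_top_sub hvL hDu)
  have h3 := l2norm_add_le hab.le (memLp_top_sub hDg hDu) (memLp_top_sub hDu hvL)
  have h4 := l2norm_diffQuot_le hab.le (memLp_top_sub hg hu) (hgper.sub huper) hs
  simp only [sub_add_sub_cancel] at h2 h3
  have h5 : (fun x => 1 / s * ((g (x + s) - u (x + s)) - (g x - u x))) =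
      fun x => 1 / s * (g (x + s) - g x) - 1 / s * (u (x + s) - u x) := by
    funext x; ring
  rw [h5] at h4
  have h6 := l2norm_sub_comm (a := a) (b := b) v fun x => (1 / s) * (u (x + s) - u x)
  linarith

/-- Integrability in the nonlocal variable of the discrete flux term. -/
theorem intervalIntegrable_opK_of_mem_dgSpace (M : Mesh a b) (hab : a < b) {k : ℕ} {δ : ℝ}
    (hδ : 0 < δ) {γ : ℝ → ℝ} (hγ : IntervalIntegrable γ volume 0 δ) {g φ : ℝ → ℝ}
    {r : ℝ → ℝ → ℝ} (hg : MemLp g ⊤ volume) (hper : Function.Periodic g (b - a))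
    (hφ : MemLp φ ⊤ volume) (hr : ∀ s ∈ Ioc 0 δ, r s ∈ M.dgSpace k)
    (h : ∀ s ∈ Ioc 0 δ, ∀ w ∈ M.dgSpace k, ∀ j,
      (∫ x in (M.left j)..(M.right j), r s x * w x) - M.opH j g w s = 0) (j : Fin M.N) :
    IntervalIntegrable (fun s => s ^ 2 * γ s * M.opK j (r s) φ s) volume 0 δ := by
  have hd : ∀ i : Fin M.N, _ := fun i => exists_dual_polynomials k (M.left_lt_right i)
  choose n p ψ hp hψ hrep using hd
  let ι := Σ i : Fin M.N, Fin (n i)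
  let G : ι → ℝ → ℝ := fun m => M.glue hab fun i x => if i = m.1 then (p m.1 m.2).eval x else 0
  let Ψ : ι → ℝ → ℝ := fun m => M.glue hab fun _ x => (ψ m.1 m.2).eval x
  have hG : ∀ m, MemLp (G m) ⊤ volume := fun m => M.memLp_top_glue hab fun i => by
    by_cases hi : i = m.1
    · simp only [hi, if_true]; exact (p m.1 m.2).continuous
    · simp only [hi, if_false]; exact continuous_const
  have hΨ : ∀ m, Ψ m ∈ M.dgSpace k := fun m => M.glue_mem_dgSpace hab _ fun _ => hψ _ _
  -- Expanding `r s` in a basis supported on single cells turns its coefficients into moments, which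
  -- the weak form identifies with `opH` of `g`. The dependence on `s` is then explicit and
  -- measurable.
  have hexp : ∀ s ∈ Ioc 0 δ, M.opK j (r s) φ s =
      ∑ m : ι, M.opH m.1 g (Ψ m) s * M.opK j (G m) φ s := by
    intro s hs
    rw [← M.opK_sum_mul j Finset.univ (fun m : ι => M.opH m.1 g (Ψ m) s) hG hφ]
    refine M.opK_congr_ae j (M.ae_eq_of_eq_on_cells hab (hr s hs).1 ?_ ?_) s
    · intro x
      exact Finset.sum_congr rfl fun m _ => by simp only [G, M.glue_periodic hab _ x]
    · intro i x hx
      obtain ⟨f, hf, hfr⟩ := (hr s hs).2 i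
      rw [hfr x hx, hrep i f hf x, Fintype.sum_sigma, Finset.sum_eq_single i]
      · refine Finset.sum_congr rfl fun m _ => ?_
        simp only [G, M.glue_of_mem_cell hab _ hx, if_true]
        congr 1
        rw [← sub_eq_zero.1 (h s hs _ (hΨ ⟨i, m⟩) i)]
        refine M.integral_cell_congr i fun y hy => ?_
        simp only [Ψ, M.glue_of_mem_cell hab _ hy, hfr y hy]
      · intro i' _ hi'
        refine Finset.sum_eq_zero fun m _ => ?_
        simp only [G, M.glue_of_mem_cell hab _ hx, if_neg (Ne.symm hi'), mul_zero]
      · simp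
  have hmeas : AEStronglyMeasurable (fun s => s ^ 2 * γ s * M.opK j (r s) φ s)
      (volume.restrict (Ioc 0 δ)) := by
    have h1 : AEStronglyMeasurable
        (fun s => s ^ 2 * γ s * ∑ m : ι, M.opH m.1 g (Ψ m) s * M.opK j (G m) φ s)
        (volume.restrict (Ioc 0 δ)) := by
      refine ((Continuous.aestronglyMeasurable (by fun_prop)).mul
        ((intervalIntegrable_iff_integrableOn_Ioc_of_le hδ.le).1 hγ).aestronglyMeasurable).mul ?_
      refine Finset.aestronglyMeasurable_fun_sum _ fun m _ => ?_
      exact ((M.aestronglyMeasurable_opH m.1 hg.1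
        (M.memLp_top_of_mem_dgSpace hab (hΨ m)).1).restrict).mul
        ((M.aestronglyMeasurable_opK j (hG m).1 hφ.1).restrict)
    refine h1.congr ((ae_restrict_iff' measurableSet_Ioc).2
      (Filter.Eventually.of_forall fun s hs => ?_))
    simp only [hexp s hs]
  rw [intervalIntegrable_iff_integrableOn_Ioc_of_le hδ.le]
  have hγ' := (intervalIntegrable_iff_integrableOn_Ioc_of_le hδ.le).1 hγ
  -- Each difference quotient costs a factor `2 / s`; the weight `s²` leaves the constant 4.
  refine Integrable.mono' (hγ'.norm.mul_const (4 * l2norm a b g * l2norm a b φ)) hmeas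
    ((ae_restrict_iff' measurableSet_Ioc).2 (Filter.Eventually.of_forall fun s hs => ?_))
  have hs : 0 < s := hs.1
  have hrs := hr s ‹_›
  have h1 := M.abs_opK_le hab j (M.memLp_top_of_mem_dgSpace hab hrs) hrs.1 hφ hs
  have h2 := M.l2norm_le_of_opH hab hs hg hper hrs (h s ‹_›)
  have h3 : |M.opK j (r s) φ s| ≤ 2 / s * (2 / s * l2norm a b g) * l2norm a b φ :=
    h1.trans (mul_le_mul_of_nonneg_right (mul_le_mul_of_nonneg_left h2 (by positivity))
      (l2norm_nonneg _ _ _))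
  rw [norm_mul, norm_mul, Real.norm_eq_abs, Real.norm_eq_abs (M.opK _ _ _ _),
    abs_of_nonneg (sq_nonneg s)]
  calc s ^ 2 * ‖γ s‖ * |M.opK j (r s) φ s|
      ≤ s ^ 2 * ‖γ s‖ * (2 / s * (2 / s * l2norm a b g) * l2norm a b φ) := by gcongr
    _ = ‖γ s‖ * (4 * l2norm a b g * l2norm a b φ) := by field_simp; ring

/-- Fubini's theorem for the nonlocal operator applied to a bounded continuous function. -/
theorem integral_nonlocal_mul_eq (M : Mesh a b) {δ : ℝ}
    (hδ : 0 < δ) {γ : ℝ → ℝ} (hγ : IntervalIntegrable γ volume 0 δ) {u φ : ℝ → ℝ}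
    {q : ℝ → ℝ → ℝ} (hu : Continuous u) (hub : ∃ D, ∀ x, |u x| ≤ D) (hφ : MemLp φ ⊤ volume)
    (hq : ∀ s ∈ Ioc 0 δ, ∀ x, q s x = (1 / s) * (u (x + s) - u x)) (j : Fin M.N) :
    IntervalIntegrable (fun s => s ^ 2 * γ s * M.opK j (q s) φ s) volume 0 δ ∧
      ∫ x in (M.left j)..(M.right j),
        (∫ s in (0 : ℝ)..δ, s ^ 2 * γ s * ((1 / s) * (q s x - q s (x - s)))) * φ x =
      ∫ s in (0 : ℝ)..δ, s ^ 2 * γ s * M.opK j (q s) φ s := by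
  obtain ⟨D, hD⟩ := hub
  have hlr := (M.left_lt_right j).le
  -- After cancelling `s²` only this bounded second difference remains, multiplied by the integrable
  -- `γ`, so Fubini applies.
  set Δ : ℝ → ℝ → ℝ := fun s x => u (x + s) - u x - (u x - u (x - s)) with hΔ
  have hγ' := (intervalIntegrable_iff_integrableOn_Ioc_of_le hδ.le).1 hγ
  have hφ' := (intervalIntegrable_iff_integrableOn_Ioc_of_le hlr).1
    (intervalIntegrable_of_memLp_top hφ (M.left j) (M.right j))
  have hint : Integrable (fun p : ℝ × ℝ => γ p.1 * Δ p.1 p.2 * φ p.2)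
      ((volume.restrict (Ioc 0 δ)).prod (volume.restrict (Ioc (M.left j) (M.right j)))) := by
    have h1 : Integrable (fun p : ℝ × ℝ => γ p.1 * φ p.2)
      ((volume.restrict (Ioc 0 δ)).prod (volume.restrict (Ioc (M.left j) (M.right j)))) :=
      hγ'.mul_prod hφ'
    have h2 := h1.bdd_mul (f := fun p : ℝ × ℝ => Δ p.1 p.2) (c := 4 * D)
      (Continuous.aestronglyMeasurable (by simp only [hΔ]; fun_prop))
      (Filter.Eventually.of_forall fun p => by
        rw [Real.norm_eq_abs, abs_le]
        have h1 := abs_le.1 (hD (p.2 + p.1))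
        have h2 := abs_le.1 (hD p.2)
        have h3 := abs_le.1 (hD (p.2 - p.1))
        constructor <;> simp only [hΔ] <;> linarith [h1.1, h1.2, h2.1, h2.2, h3.1, h3.2])
    refine h2.congr (Filter.Eventually.of_forall fun p => ?_)
    simp only
    ring
  have hpt : ∀ s ∈ Ioc 0 δ, ∀ x, s ^ 2 * γ s * ((1 / s) * (q s x - q s (x - s))) =
      γ s * Δ s x := by
    intro s hs x
    have h0 : s ≠ 0 := hs.1.ne'
    rw [hq s hs, hq s hs, sub_add_cancel]
    simp only [hΔ]
    field_simp
  have hK : ∀ s ∈ Ioc 0 δ, s ^ 2 * γ s * M.opK j (q s) φ s =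
      ∫ x in Ioc (M.left j) (M.right j), γ s * Δ s x * φ x := by
    intro s hs
    rw [opK, intervalIntegral.integral_of_le hlr, ← integral_const_mul]
    refine setIntegral_congr_fun measurableSet_Ioc fun x _ => ?_
    rw [← hpt s hs x]
    ring
  constructor
  · rw [intervalIntegrable_iff_integrableOn_Ioc_of_le hδ.le]
    exact hint.integral_prod_left.congr ((ae_restrict_iff' measurableSet_Ioc).2
      (Filter.Eventually.of_forall fun s hs => (hK s hs).symm))
  · simp only [intervalIntegral.integral_of_le hlr, intervalIntegral.integral_of_le hδ.le]
    rw [setIntegral_congr_fun measurableSet_Ioc hK, integral_integral_swap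
      (f := fun s x => γ s * Δ s x * φ x) hint]
    refine setIntegral_congr_fun measurableSet_Ioc fun x _ => ?_
    rw [integral_mul_const, setIntegral_congr_fun measurableSet_Ioc fun s hs => hpt s hs x]

/-- Consistency and stability of the discretized nonlocal operator, tested with `φ`. -/
theorem abs_sum_integral_opK_sub_le (M : Mesh a b) (hab : a < b) {k : ℕ} {δ ε : ℝ}
    (hδ : 0 < δ) (hε : 0 ≤ ε) {γ : ℝ → ℝ} (hγ : IntervalIntegrable γ volume 0 δ)
    (hγ0 : ∀ s, 0 ≤ γ s) {g φ u : ℝ → ℝ} {r q : ℝ → ℝ → ℝ} (hg : g ∈ M.dgSpace k)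
    (hφ : MemLp φ ⊤ volume) (hr : ∀ s ∈ Ioc 0 δ, r s ∈ M.dgSpace k)
    (h : ∀ s ∈ Ioc 0 δ, ∀ w ∈ M.dgSpace k, ∀ j,
      (∫ x in (M.left j)..(M.right j), r s x * w x) - M.opH j g w s = 0)
    (hu : Continuous u) (huper : Function.Periodic u (b - a))
    (hq : ∀ s ∈ Ioc 0 δ, ∀ x, q s x = (1 / s) * (u (x + s) - u x))
    (happ : ∀ s ∈ Ioc 0 δ, ∃ v ∈ M.dgSpace k, l2norm a b (fun x => v x - q s x) ≤ ε) :
    |∑ j, (2 * (∫ s in (0 : ℝ)..δ, s ^ 2 * γ s * M.opK j (r s) φ s)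
      - 2 * ∫ s in (0 : ℝ)..δ, s ^ 2 * γ s * M.opK j (q s) φ s)| ≤
    8 * (∫ s in (0 : ℝ)..δ, γ s) * (l2norm a b (fun x => g x - u x) + δ * ε) * l2norm a b φ := by
  have huL := memLp_top_of_continuous_periodic (sub_pos.2 hab) hu huper
  have hgL := M.memLp_top_of_mem_dgSpace hab hg
  have hub := exists_abs_le_of_continuous_periodic (sub_pos.2 hab) hu huper
  have hI1 := M.intervalIntegrable_opK_of_mem_dgSpace hab hδ hγ hgL hg.1 hφ hr h
  have hI2 := fun j => (M.integral_nonlocal_mul_eq hδ hγ hu hub hφ hq j).1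
  set m := l2norm a b (fun x => g x - u x) with hm
  have hm0 : 0 ≤ m := l2norm_nonneg _ _ _
  have hφ0 : 0 ≤ l2norm a b φ := l2norm_nonneg _ _ _
  have hsum : ∑ j, (2 * (∫ s in (0 : ℝ)..δ, s ^ 2 * γ s * M.opK j (r s) φ s)
      - 2 * ∫ s in (0 : ℝ)..δ, s ^ 2 * γ s * M.opK j (q s) φ s) =
      ∫ s in (0 : ℝ)..δ, 2 * ∑ j, (s ^ 2 * γ s * M.opK j (r s) φ s
        - s ^ 2 * γ s * M.opK j (q s) φ s) := by
    rw [intervalIntegral.integral_const_mul,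
      intervalIntegral.integral_finsetSum fun j _ => (hI1 j).sub (hI2 j), Finset.mul_sum]
    refine Finset.sum_congr rfl fun j _ => ?_
    rw [intervalIntegral.integral_sub (hI1 j) (hI2 j)]
    ring
  rw [hsum, ← Real.norm_eq_abs]
  have hrhs : 8 * (∫ s in (0 : ℝ)..δ, γ s) * (m + δ * ε) * l2norm a b φ =
      ∫ s in (0 : ℝ)..δ, γ s * (8 * (m + δ * ε) * l2norm a b φ) := by
    rw [intervalIntegral.integral_mul_const]
    ring
  rw [hrhs]
  refine intervalIntegral.norm_integral_le_of_norm_le hδ.le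
    (Filter.Eventually.of_forall fun s hs => ?_) (hγ.mul_const _)
  have hs0 : 0 < s := hs.1
  have hqs : q s = fun x => (1 / s) * (u (x + s) - u x) := funext (hq s hs)
  have hqL : MemLp (q s) ⊤ volume := by
    rw [hqs]
    exact memLp_top_const_mul (memLp_top_sub (memLp_top_comp_add huL s) huL) _
  have hqper : Function.Periodic (q s) (b - a) := by
    intro x
    rw [hqs]
    simp only
    rw [huper x, add_right_comm, huper]
  have hrL := M.memLp_top_of_mem_dgSpace hab (hr s hs)
  have happ' := happ s hs
  have h1 := M.l2norm_sub_diffQuot_le hab hs0 hgL hg.1 (hr s hs) huL huper (h s hs)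
    (by rw [hqs] at happ'; exact happ')
  have h2 := M.abs_sum_opK_le hab (memLp_top_sub hrL hqL) ((hr s hs).1.sub hqper) hφ hs0
  have h3 : ∑ j, (s ^ 2 * γ s * M.opK j (r s) φ s - s ^ 2 * γ s * M.opK j (q s) φ s) =
      s ^ 2 * γ s * ∑ j, M.opK j (fun x => r s x - q s x) φ s := by
    rw [Finset.mul_sum]
    exact Finset.sum_congr rfl fun j _ => by rw [M.opK_sub j hrL hqL hφ]; ring
  rw [h3, norm_mul, norm_mul, Real.norm_eq_abs 2, Real.norm_eq_abs (s ^ 2 * γ s),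
    abs_of_pos (two_pos : (0 : ℝ) < 2), abs_of_nonneg (mul_nonneg (sq_nonneg s) (hγ0 s)),
    Real.norm_eq_abs]
  have h4 : l2norm a b (fun x => r s x - q s x) ≤ 2 / s * m + 2 * ε := by
    rw [hqs]; exact h1
  have hγs := hγ0 s
  -- The error of the gradient loses `2 / s` on `m`, and the backward quotient loses `2 / s` again;
  -- `s²` cancels both and leaves `s ε`, bounded by `δ ε`.
  calc 2 * (s ^ 2 * γ s * |∑ j, M.opK j (fun x => r s x - q s x) φ s|)
      ≤ 2 * (s ^ 2 * γ s * (2 / s * (2 / s * m + 2 * ε) * l2norm a b φ)) := by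
        gcongr
        refine h2.trans ?_
        gcongr
    _ = γ s * (8 * (m + s * ε) * l2norm a b φ) := by field_simp; ring
    _ ≤ γ s * (8 * (m + δ * ε) * l2norm a b φ) := by
        have := hs.2
        gcongr

end Mesh

/-! ### The error equation and the error estimate. -/

theorem IsSmoothSolution.isBddContOn {a b T δ : ℝ} {γ : ℝ → ℝ} {k : ℕ} {u : ℝ → ℝ → ℝ}
    {q : ℝ → ℝ → ℝ → ℝ} (h : IsSmoothSolution a b T δ γ k u q) (l r : ℝ) :
    IsBddContOn T l r u ∧ IsBddContOn T l r (timeDeriv T u) ∧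
      IsBddContOn T l r (timeDeriv T (timeDeriv T u)) :=
  ⟨isBddContOn_of_continuousOn h.continuous_u l r, isBddContOn_of_continuousOn h.continuous_ut l r,
    isBddContOn_of_continuousOn h.continuous_utt l r⟩

namespace Mesh

variable {a b : ℝ}

theorem IsDGSolution.isBddContOn {M : Mesh a b} {k : ℕ} {T δ : ℝ} (hT : 0 < T) {γ : ℝ → ℝ}
    {uh : ℝ → ℝ → ℝ} {qh : ℝ → ℝ → ℝ → ℝ} (h : M.IsDGSolution k T δ γ uh qh) (j : Fin M.N) :
    IsBddContOn T (M.left j) (M.right j) uh ∧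
      IsBddContOn T (M.left j) (M.right j) (timeDeriv T uh) ∧
      IsBddContOn T (M.left j) (M.right j) (timeDeriv T (timeDeriv T uh)) := by
  have hlr := M.left_lt_right j
  have h0 := fun t ht => (h.mem_uh t ht).2 j
  have hc := h.contDiff_time j
  have hc1 := fun x hx => contDiffOn_one_timeDeriv hT (hc x hx)
  have h1 := exists_polynomial_timeDeriv hlr h0 fun x hx => (hc x hx).differentiableOn (by norm_num)
  have h2 := exists_polynomial_timeDeriv hlr h1 fun x hx =>
    (hc1 x hx).differentiableOn (by norm_num)
  exact ⟨isBddContOn_of_polynomial hlr h0 fun x hx => (hc x hx).continuousOn,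
    isBddContOn_of_polynomial hlr h1 fun x hx => (hc1 x hx).continuousOn,
    isBddContOn_of_polynomial hlr h2 fun x hx => continuousOn_timeDeriv hT (hc1 x hx)⟩

theorem integral_sub_mul_eq_zero_of_isL2Projection (M : Mesh a b) {k : ℕ} {f g : ℝ → ℝ}
    (h : M.IsL2Projection k f g) {p : Polynomial ℝ} (hp : p.natDegree ≤ k) (j : Fin M.N) :
    ∫ x in (M.left j)..(M.right j), (g x - f x) * p.eval x = 0 := by
  have h1 := h.2 j p hp
  rw [← neg_eq_zero, ← intervalIntegral.integral_neg, ← h1]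
  congr 1
  funext x
  ring

theorem sum_integral_cells_mul (M : Mesh a b) {f φ : ℝ → ℝ} (hf : MemLp f ⊤ volume)
    (hφ : MemLp φ ⊤ volume) {P : Fin M.N → Polynomial ℝ}
    (hP : ∀ j, ∀ x ∈ Ioo (M.left j) (M.right j), φ x = (P j).eval x) :
    ∑ j, ∫ x in (M.left j)..(M.right j), f x * (P j).eval x = ∫ x in a..b, f x * φ x := by
  rw [← M.sum_integral_cells fun l r => intervalIntegrable_of_memLp_top (memLp_top_mul hf hφ) l r]
  exact Finset.sum_congr rfl fun j _ => M.integral_cell_congr j fun x hx => by rw [hP j x hx]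

/-- Integrating the error equation twice in time: the error tested with a fixed function of the
discontinuous Galerkin space. -/
theorem abs_integral_error_mul_le (M : Mesh a b) (hab : a < b) {k : ℕ} {T δ : ℝ} (hT : 0 < T)
    {γ : ℝ → ℝ} {u : ℝ → ℝ → ℝ} {q : ℝ → ℝ → ℝ → ℝ} {uh : ℝ → ℝ → ℝ} {qh : ℝ → ℝ → ℝ → ℝ}
    (hu : IsSmoothSolution a b T δ γ k u q) (huh : M.IsDGSolution k T δ γ uh qh)
    (h0 : M.IsL2Projection k (u 0) (uh 0))
    (h1 : M.IsL2Projection k (timeDeriv T u 0) (timeDeriv T uh 0))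
    {φ : ℝ → ℝ} (hφ : φ ∈ M.dgSpace k) {α β lam : ℝ} (hα : 0 ≤ α) (hβ : 0 ≤ β) (hlam : 0 < lam)
    (hbound : ∀ t ∈ Ioo 0 T, |∑ j, ∫ x in (M.left j)..(M.right j),
      (timeDeriv T (timeDeriv T uh) t x - timeDeriv T (timeDeriv T u) t x) * φ x| ≤
        α * Real.exp (lam * t) + β) :
    ∀ t ∈ Icc 0 T, |∫ x in a..b, (uh t x - u t x) * φ x| ≤
      α / lam ^ 2 * Real.exp (lam * t) + β * T ^ 2 := by
  obtain ⟨P, hP, hφP⟩ : ∃ P : Fin M.N → Polynomial ℝ, (∀ j, (P j).natDegree ≤ k) ∧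
      ∀ j, ∀ x ∈ Ioo (M.left j) (M.right j), φ x = (P j).eval x := by
    choose P hP hφP using hφ.2
    exact ⟨P, hP, hφP⟩
  have hφL := M.memLp_top_of_mem_dgSpace hab hφ
  have hstep : ∀ {F G : ℝ → ℝ → ℝ},
      (∀ j, IsBddContOn T (M.left j) (M.right j) F) →
      (∀ j, IsBddContOn T (M.left j) (M.right j) G) →
      (∀ j, ∀ x ∈ Ioo (M.left j) (M.right j), ∀ t ∈ Ioo 0 T,
        HasDerivAt (fun t => F t x) (G t x) t) →
      ∀ t ∈ Icc 0 T, (∑ j, ∫ x in (M.left j)..(M.right j), F t x * (P j).eval x) -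
        (∑ j, ∫ x in (M.left j)..(M.right j), F 0 x * (P j).eval x) =
        ∫ τ in (0 : ℝ)..t, ∑ j, ∫ x in (M.left j)..(M.right j), G τ x * (P j).eval x := by
    intro F G hF hG hd t ht
    have h := fun j => integral_mul_sub_eq_integral_timeDeriv (M.left_lt_right j).le (hF j) (hG j)
      (hd j) (P j).continuous ht
    rw [intervalIntegral.integral_finsetSum fun j _ => (h j).1, ← Finset.sum_sub_distrib]
    exact Finset.sum_congr rfl fun j _ => (h j).2
  have hbu := fun j => hu.isBddContOn (M.left j) (M.right j)
  have hbh := fun j => huh.isBddContOn hT j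
  -- The functions `c`, `d`, `g` are the error, its velocity and its acceleration tested with the
  -- fixed `φ`; the first two vanish at time zero by orthogonality of the projections.
  have key := abs_le_of_second_order (T := T) hα hβ hlam
    (c := fun t => ∑ j, ∫ x in (M.left j)..(M.right j), (uh t x - u t x) * (P j).eval x)
    (d := fun t => ∑ j, ∫ x in (M.left j)..(M.right j),
      (timeDeriv T uh t x - timeDeriv T u t x) * (P j).eval x)
    (g := fun t => ∑ j, ∫ x in (M.left j)..(M.right j),
      (timeDeriv T (timeDeriv T uh) t x - timeDeriv T (timeDeriv T u) t x) * (P j).eval x)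
    (Finset.sum_eq_zero fun j _ =>
      M.integral_sub_mul_eq_zero_of_isL2Projection h0 (hP j) j)
    (Finset.sum_eq_zero fun j _ =>
      M.integral_sub_mul_eq_zero_of_isL2Projection h1 (hP j) j)
    (hstep (fun j => (hbh j).1.sub (hbu j).1) (fun j => (hbh j).2.1.sub (hbu j).2.1)
      fun j x hx t ht =>
        (hasDerivAt_timeDeriv ((huh.contDiff_time j x hx).differentiableOn (by norm_num)) ht).sub
        (hasDerivAt_timeDeriv ((hu.contDiff_time x).differentiableOn (by norm_num)) ht))
    (hstep (fun j => (hbh j).2.1.sub (hbu j).2.1) (fun j => (hbh j).2.2.sub (hbu j).2.2)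
      fun j x hx t ht =>
        (hasDerivAt_timeDeriv ((contDiffOn_one_timeDeriv hT
          (huh.contDiff_time j x hx)).differentiableOn (by norm_num)) ht).sub
        (hasDerivAt_timeDeriv ((contDiffOn_one_timeDeriv hT
          (hu.contDiff_time x)).differentiableOn (by norm_num)) ht))
    (fun t ht => by
      refine le_of_eq_of_le ?_ (hbound t ht)
      congr 1
      exact Finset.sum_congr rfl fun j _ => M.integral_cell_congr j fun x hx => by
        rw [hφP j x hx])
  intro t ht
  have hut := memLp_top_of_continuous_periodic (sub_pos.2 hab) (hu.contDiff_u t ht).continuous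
    (hu.periodic t ht)
  have huht := M.memLp_top_of_mem_dgSpace hab (huh.mem_uh t ht)
  rw [← M.sum_integral_cells_mul (memLp_top_sub huht hut) hφL hφP]
  exact key t ht

/-- The semi-discrete error equation, tested with a function of the discontinuous Galerkin
space. -/
theorem abs_sum_integral_error_tt_mul_le (M : Mesh a b) (hab : a < b) {k : ℕ} {T δ ε : ℝ}
    (hT : 0 < T) (hδ : 0 < δ) (hε : 0 ≤ ε) {γ : ℝ → ℝ} (hγ : IntervalIntegrable γ volume 0 δ)
    (hγ0 : ∀ s, 0 ≤ γ s) {u : ℝ → ℝ → ℝ} {q : ℝ → ℝ → ℝ → ℝ} {uh : ℝ → ℝ → ℝ}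
    {qh : ℝ → ℝ → ℝ → ℝ}
    (hu : IsSmoothSolution a b T δ γ k u q) (huh : M.IsDGSolution k T δ γ uh qh)
    (happ : ∀ t ∈ Icc 0 T, ∀ s ∈ Ioc 0 δ,
      ∃ v ∈ M.dgSpace k, l2norm a b (fun x => v x - q t s x) ≤ ε)
    {φ : ℝ → ℝ} (hφ : φ ∈ M.dgSpace k) {t : ℝ} (ht : t ∈ Ioo 0 T) :
    |∑ j, ∫ x in (M.left j)..(M.right j),
      (timeDeriv T (timeDeriv T uh) t x - timeDeriv T (timeDeriv T u) t x) * φ x| ≤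
    8 * (∫ s in (0 : ℝ)..δ, γ s) * (l2norm a b (fun x => uh t x - u t x) + δ * ε) *
      l2norm a b φ := by
  have ht' := Ioo_subset_Icc_self ht
  have hφL := M.memLp_top_of_mem_dgSpace hab hφ
  have huc := (hu.contDiff_u t ht').continuous
  have huper := hu.periodic t ht'
  have hq : ∀ s ∈ Ioc 0 δ, ∀ x, q t s x = (1 / s) * (u t (x + s) - u t x) := fun s hs x =>
    sub_eq_zero.1 (hu.grad_eq t ht' s hs x)
  have hub : ∃ D, ∀ x, |u t x| ≤ D := exists_abs_le_of_continuous_periodic (sub_pos.2 hab) huc huper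
  refine le_of_eq_of_le ?_ (M.abs_sum_integral_opK_sub_le hab hδ hε hγ hγ0 (huh.mem_uh t ht') hφL
    (huh.mem_qh t ht') (huh.grad_eq t ht') huc huper hq (happ t ht'))
  congr 1
  refine Finset.sum_congr rfl fun j _ => ?_
  obtain ⟨P, -, hP⟩ := hφ.2 j
  have hint : ∀ {G : ℝ → ℝ → ℝ}, IsBddContOn T (M.left j) (M.right j) G →
      IntervalIntegrable (fun x => G t x * P.eval x) volume (M.left j) (M.right j) := by
    intro G hG
    rw [intervalIntegrable_iff_integrableOn_Ioo_of_le (M.left_lt_right j).le]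
    exact hG.integrable_slice P.continuous ht'
  rw [← sub_eq_zero.1 (huh.wave_eq t ht' φ hφ j),
    ← (M.integral_nonlocal_mul_eq hδ hγ huc hub hφL hq j).2,
    ← intervalIntegral.integral_const_mul,
    M.integral_cell_congr j (f := fun x => timeDeriv T (timeDeriv T uh) t x * φ x)
      (g := fun x => timeDeriv T (timeDeriv T uh) t x * P.eval x) fun x hx => by rw [hP x hx],
    M.integral_cell_congr j (f := fun x => 2 * (_ * φ x))
      (g := fun x => timeDeriv T (timeDeriv T u) t x * P.eval x) ?_,
    ← intervalIntegral.integral_sub (hint (huh.isBddContOn hT j).2.2)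
      (hint (hu.isBddContOn _ _).2.2)]
  · refine M.integral_cell_congr j fun x hx => ?_
    rw [hP x hx, sub_mul]
  · intro x hx
    have hxab : x ∈ Ioo a b :=
      ⟨(M.a_le_node _).trans_lt hx.1, hx.2.trans_le (M.node_le_b _)⟩
    rw [sub_eq_zero.1 (hu.wave_eq t ht x hxab), hP x hx, mul_assoc]

/-- A qualitative bound, possibly depending on the mesh and the solution, whose only role is to make
the weighted supremum of the error finite. -/
theorem exists_l2norm_error_le (M : Mesh a b) (hab : a < b) {k : ℕ} {T δ : ℝ} (hT : 0 < T)
    {γ : ℝ → ℝ} {u : ℝ → ℝ → ℝ} {q : ℝ → ℝ → ℝ → ℝ} {uh : ℝ → ℝ → ℝ} {qh : ℝ → ℝ → ℝ → ℝ}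
    (hu : IsSmoothSolution a b T δ γ k u q) (huh : M.IsDGSolution k T δ γ uh qh) :
    ∃ B, ∀ t ∈ Icc 0 T, l2norm a b (fun x => uh t x - u t x) ≤ B := by
  have h : ∀ j, ∃ B, ∀ t ∈ Icc 0 T, ∀ x ∈ Ioo (M.left j) (M.right j), |uh t x - u t x| ≤ B :=
    fun j => ((huh.isBddContOn hT j).1.sub (hu.isBddContOn _ _).1).2
  choose B hB using h
  refine ⟨Real.sqrt (∑ j, ∫ _ in (M.left j)..(M.right j), B j ^ 2), fun t ht => ?_⟩
  have hut := memLp_top_of_continuous_periodic (sub_pos.2 hab) (hu.contDiff_u t ht).continuous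
    (hu.periodic t ht)
  have huht := M.memLp_top_of_mem_dgSpace hab (huh.mem_uh t ht)
  have hi := fun l r => intervalIntegrable_sq_of_memLp_top (memLp_top_sub huht hut) l r
  refine Real.sqrt_le_sqrt ?_
  rw [← M.sum_integral_cells hi]
  refine Finset.sum_le_sum fun j _ => ?_
  refine intervalIntegral.integral_mono_on_of_le_Ioo (M.left_lt_right j).le (hi _ _)
    intervalIntegrable_const fun x hx => ?_
  rw [← sq_abs]
  exact pow_le_pow_left₀ (abs_nonneg _) (hB j t ht x hx) 2

/-- The error estimate in terms of the approximation error `ε` of the solution. -/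
theorem l2norm_error_le (M : Mesh a b) (hab : a < b) {k : ℕ} {T δ ε : ℝ}
    (hT : 0 < T) (hδ : 0 < δ) (hε : 0 ≤ ε) {γ : ℝ → ℝ} (hγ : IntervalIntegrable γ volume 0 δ)
    (hγ0 : ∀ s, 0 ≤ γ s) {u : ℝ → ℝ → ℝ} {q : ℝ → ℝ → ℝ → ℝ} {uh : ℝ → ℝ → ℝ}
    {qh : ℝ → ℝ → ℝ → ℝ}
    (hu : IsSmoothSolution a b T δ γ k u q) (huh : M.IsDGSolution k T δ γ uh qh)
    (h0 : M.IsL2Projection k (u 0) (uh 0))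
    (h1 : M.IsL2Projection k (timeDeriv T u 0) (timeDeriv T uh 0))
    (happu : ∀ t ∈ Icc 0 T, ∃ v ∈ M.dgSpace k, l2norm a b (fun x => v x - u t x) ≤ ε)
    (happq : ∀ t ∈ Icc 0 T, ∀ s ∈ Ioc 0 δ,
      ∃ v ∈ M.dgSpace k, l2norm a b (fun x => v x - q t s x) ≤ ε) :
    ∀ t ∈ Icc 0 T, l2norm a b (fun x => uh t x - u t x) ≤
      2 * (8 * (∫ s in (0 : ℝ)..δ, γ s) * δ * ε * T ^ 2 + 2 * ε) *
        Real.exp (Real.sqrt (16 * (∫ s in (0 : ℝ)..δ, γ s) + 1) * t) := by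
  set Γ := ∫ s in (0 : ℝ)..δ, γ s with hΓ
  have hΓ0 : 0 ≤ Γ := intervalIntegral.integral_nonneg hδ.le fun s _ => hγ0 s
  -- Chosen so that `8 Γ / lam² ≤ 1 / 2`; the added 1 keeps `lam` positive even for `Γ = 0`.
  set lam := Real.sqrt (16 * Γ + 1) with hlam
  have hlam0 : 0 < lam := Real.sqrt_pos.2 (by positivity)
  have hlam2 : lam ^ 2 = 16 * Γ + 1 := Real.sq_sqrt (by positivity)
  refine le_of_forall_bound_improves hT.le hlam0.le (fun t _ => l2norm_nonneg _ _ _)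
    (M.exists_l2norm_error_le hab hT hu huh) fun R hR hbound t ht => ?_
  obtain ⟨v, hv, hvε⟩ := happu t ht
  have hut := memLp_top_of_continuous_periodic (sub_pos.2 hab) (hu.contDiff_u t ht).continuous
    (hu.periodic t ht)
  have huhm := huh.mem_uh t ht
  have huht := M.memLp_top_of_mem_dgSpace hab huhm
  have hvL := M.memLp_top_of_mem_dgSpace hab hv
  -- The time `t` is frozen here: `φ` stays fixed while the error equation is integrated over
  -- earlier times.
  set φ : ℝ → ℝ := fun x => uh t x - v x with hφdef
  have hφ : φ ∈ M.dgSpace k := (M.dgSpace k).sub_mem huhm hv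
  have hφL := M.memLp_top_of_mem_dgSpace hab hφ
  set Φ := l2norm a b φ with hΦ
  have hΦ0 : 0 ≤ Φ := l2norm_nonneg _ _ _
  have hc := M.abs_integral_error_mul_le hab hT hu huh h0 h1 hφ
    (α := 8 * Γ * R * Φ) (β := 8 * Γ * (δ * ε) * Φ) (lam := lam) (by positivity) (by positivity)
    hlam0 (fun r hr => by
      refine (M.abs_sum_integral_error_tt_mul_le hab hT hδ hε hγ hγ0 hu huh happq hφ hr).trans ?_
      have h2 := hbound r (Ioo_subset_Icc_self hr)
      calc 8 * Γ * (l2norm a b (fun x => uh r x - u r x) + δ * ε) * Φ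
          ≤ 8 * Γ * (R * Real.exp (lam * r) + δ * ε) * Φ := by gcongr
        _ = 8 * Γ * R * Φ * Real.exp (lam * r) + 8 * Γ * (δ * ε) * Φ := by ring) t ht
  set E := Real.exp (lam * t) with hE
  have hE1 : 1 ≤ E := Real.one_le_exp (mul_nonneg hlam0.le ht.1)
  have hratio : 8 * Γ / lam ^ 2 ≤ 1 / 2 := by
    rw [hlam2, div_le_iff₀ (by positivity)]
    linarith
  have hvu : l2norm a b (fun x => u t x - v x) ≤ ε := by rwa [l2norm_sub_comm]
  have hsq : ∫ x in a..b, φ x ^ 2 ≤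
      (R / 2 * E + 8 * Γ * δ * ε * T ^ 2 + ε) * Φ := by
    have h2 : ∫ x in a..b, φ x ^ 2 =
        (∫ x in a..b, (uh t x - u t x) * φ x) + ∫ x in a..b, (u t x - v x) * φ x := by
      rw [← intervalIntegral.integral_add
        (intervalIntegrable_of_memLp_top (memLp_top_mul (memLp_top_sub huht hut) hφL) a b)
        (intervalIntegrable_of_memLp_top (memLp_top_mul (memLp_top_sub hut hvL) hφL) a b)]
      congr 1
      funext x
      simp only [hφdef]
      ring
    have h3 := (le_abs_self _).trans hc
    have h4 := (le_abs_self _).trans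
      (abs_integral_mul_le_l2norm hab.le (memLp_top_sub hut hvL) hφL)
    have h5 : l2norm a b (fun x => u t x - v x) * Φ ≤ ε * Φ := by gcongr
    have h6 : 8 * Γ * R * Φ / lam ^ 2 * E ≤ R / 2 * E * Φ := by
      calc 8 * Γ * R * Φ / lam ^ 2 * E = (8 * Γ / lam ^ 2) * (R * Φ * E) := by ring
        _ ≤ 1 / 2 * (R * Φ * E) := by gcongr
        _ = R / 2 * E * Φ := by ring
    rw [h2]
    calc _ ≤ (8 * Γ * R * Φ / lam ^ 2 * E + 8 * Γ * (δ * ε) * Φ * T ^ 2) + ε * Φ :=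
          add_le_add h3 (h4.trans h5)
      _ ≤ (R / 2 * E * Φ + 8 * Γ * (δ * ε) * Φ * T ^ 2) + ε * Φ := by gcongr
      _ = _ := by ring
  -- Every term of the bound on `Φ²` carries a factor `Φ`, which is divided out.
  have hΦle := l2norm_le_of_integral_sq_le hab.le hsq (by positivity)
  have htri := l2norm_add_le hab.le hφL (memLp_top_sub hvL hut)
  simp only [hφdef, sub_add_sub_cancel] at htri
  set K := 8 * Γ * δ * ε * T ^ 2 + 2 * ε with hK
  have hK0 : 0 ≤ K := by positivity
  calc l2norm a b (fun x => uh t x - u t x) ≤ Φ + ε := htri.trans (add_le_add le_rfl hvε)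
    _ ≤ R / 2 * E + K := by simp only [hK]; linarith
    _ ≤ R / 2 * E + K * E := by
        have := le_mul_of_one_le_right hK0 hE1
        linarith
    _ = (R / 2 + K) * E := by ring

end Mesh

end

end NonlocalWave

theorem theorem3p2 (a b T δ ν : ℝ) (hab : a < b) (hT : 0 < T) (hδ : 0 < δ) (hν : 0 < ν) (k : ℕ)
    (γ : ℝ → ℝ) (hγ : NonlocalWave.IsKernel δ γ) (hγ_loc : LocallyIntegrable γ volume) (A : ℝ) :
    ∃ C : ℝ, 0 < C ∧
      ∀ (u : ℝ → ℝ → ℝ) (q : ℝ → ℝ → ℝ → ℝ),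
        NonlocalWave.IsSmoothSolution a b T δ γ k u q →
        (∀ t ∈ Icc 0 T, NonlocalWave.sobolevSeminorm a b (k + 1) (u t) ≤ A) →
        (∀ t ∈ Icc 0 T,
          NonlocalWave.sobolevSeminorm a b (k + 1) (NonlocalWave.timeDeriv T u t) ≤ A) →
        (∀ t ∈ Icc 0 T, ∀ s ∈ Ioc 0 δ, NonlocalWave.sobolevSeminorm a b (k + 1) (q t s) ≤ A) →
        ∀ M : NonlocalWave.Mesh a b, M.IsRegular ν →
        ∀ (uh : ℝ → ℝ → ℝ) (qh : ℝ → ℝ → ℝ → ℝ),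
          M.IsDGSolution k T δ γ uh qh →
          M.IsL2Projection k (u 0) (uh 0) →
          M.IsL2Projection k (NonlocalWave.timeDeriv T u 0) (NonlocalWave.timeDeriv T uh 0) →
          ∀ t ∈ Icc 0 T, (∫ x in a..b, (uh t x - u t x) ^ 2) ≤ C * M.size ^ (2 * k + 2) := by
  -- Integrability of `γ` itself, not merely of `s² γ`, is what makes the operator bounded.
  have hγi : IntervalIntegrable γ volume 0 δ :=
    (hγ_loc.integrableOn_isCompact isCompact_uIcc).intervalIntegrable
  set D := 2 * (8 * (∫ s in (0 : ℝ)..δ, γ s) * δ * T ^ 2 + 2) * A *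
    Real.exp (Real.sqrt (16 * (∫ s in (0 : ℝ)..δ, γ s) + 1) * T) with hD
  -- The added 1 makes the constant positive even when `D = 0`, for instance when `A = 0`.
  refine ⟨D ^ 2 + 1, by positivity, ?_⟩
  intro u q hu hAu _ hAq M _ uh qh huh h0 h1 t ht
  -- The sign of `A` is not assumed; it follows once a solution obeying the bounds is given.
  have hA : 0 ≤ A := (Real.sqrt_nonneg _).trans (hAu 0 ⟨le_rfl, hT.le⟩)
  have hh := M.size_nonneg
  have hΓ0 : 0 ≤ ∫ s in (0 : ℝ)..δ, γ s :=
    intervalIntegral.integral_nonneg hδ.le fun s _ => hγ.nonneg s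
  have happu : ∀ t ∈ Icc 0 T, ∃ v ∈ M.dgSpace k,
      NonlocalWave.l2norm a b (fun x => v x - u t x) ≤ M.size ^ (k + 1) * A := by
    intro t ht
    obtain ⟨v, hv, hvu⟩ :=
      M.exists_mem_dgSpace_l2norm_sub_le hab (hu.contDiff_u t ht) (hu.periodic t ht)
    exact ⟨v, hv, hvu.trans (mul_le_mul_of_nonneg_left (hAu t ht) (by positivity))⟩
  have happq : ∀ t ∈ Icc 0 T, ∀ s ∈ Ioc 0 δ, ∃ v ∈ M.dgSpace k,
      NonlocalWave.l2norm a b (fun x => v x - q t s x) ≤ M.size ^ (k + 1) * A := by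
    intro t ht s hs
    have hq : q t s = fun x => (1 / s) * (u t (x + s) - u t x) := funext fun x =>
      sub_eq_zero.1 (hu.grad_eq t ht s hs x)
    have huc := hu.contDiff_u t ht
    have hper := hu.periodic t ht
    have hqc : ContDiff ℝ ((k + 1 : ℕ) : WithTop ℕ∞) (q t s) := by
      rw [hq]
      exact contDiff_const.mul ((huc.comp (contDiff_id.add contDiff_const)).sub huc)
    have hqper : Function.Periodic (q t s) (b - a) := by
      intro x
      rw [hq]
      simp only
      rw [hper x, add_right_comm, hper]
    obtain ⟨v, hv, hvq⟩ := M.exists_mem_dgSpace_l2norm_sub_le hab hqc hqper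
    exact ⟨v, hv, hvq.trans (mul_le_mul_of_nonneg_left (hAq t ht s hs) (by positivity))⟩
  have herr := M.l2norm_error_le hab hT hδ (by positivity) hγi hγ.nonneg hu huh h0 h1 happu happq
    t ht
  have herr' : NonlocalWave.l2norm a b (fun x => uh t x - u t x) ≤ D * M.size ^ (k + 1) := by
    refine herr.trans ?_
    calc _ ≤ 2 * (8 * (∫ s in (0 : ℝ)..δ, γ s) * δ * (M.size ^ (k + 1) * A) * T ^ 2 +
          2 * (M.size ^ (k + 1) * A)) *
          Real.exp (Real.sqrt (16 * (∫ s in (0 : ℝ)..δ, γ s) + 1) * T) := by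
          have := ht.2
          gcongr
      _ = D * M.size ^ (k + 1) := by rw [hD]; ring
  rw [← NonlocalWave.l2norm_sq hab.le]
  calc NonlocalWave.l2norm a b (fun x => uh t x - u t x) ^ 2
      ≤ (D * M.size ^ (k + 1)) ^ 2 :=
        pow_le_pow_left₀ (NonlocalWave.l2norm_nonneg _ _ _) herr' 2
    _ = D ^ 2 * M.size ^ (2 * k + 2) := by rw [mul_pow, ← pow_mul]; ring_nf
    _ ≤ (D ^ 2 + 1) * M.size ^ (2 * k + 2) := by
        gcongr
        linarith
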